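/- Let $d\in\mathbb N$, $\alpha\in(0,1]$ with $d>\alpha$, and let $|\cdot|$ be the Euclidean norm. Let $\{w_{x,y}\}$, indexed by the unordered pairs of distinct points $x,y\in\mathbb Z^d$ (so $w_{x,y}=w_{y,x}$), be i.i.d. non-negative random variables on a probability space $(\Omega,\mathcal F,\mathbb P)$ with $\mathbb E[w_{x,y}]=1$ and $w_{x,y}\le C_1$ for some constant $C_1>0$. For $m\in\mathbb N$ put $B_{2^m}=(-2^m,2^m]^d\cap\mathbb Z^d$ and $$V_m(x)=\sum_{z\in\mathbb Z^d:\,0<|z|\le 2^m}\frac{z}{|z|^{d+\alpha}}\,w_{x,x+z},\qquad x\in\mathbb Z^d,$$ and for $f=(f^{(1)},\dots,f^{(d)}):B_{2^m}\to\mathbb R^d$ put $$\mathcal L^\omega_{B_{2^m}}f(x)=\sum_{y\in B_{2^m},\,y\ne x}(f(y)-f(x))\frac{w_{x,y}(\omega)}{|x-y|^{d+\alpha}},\qquad \mathscr E^\omega_{B_{2^m}}(f,f)=\frac12\sum_{i=1}^d\sum_{x,y\in B_{2^m},\,x\ne y}\big(f^{(i)}(x)-f^{(i)}(y)\big)^2\frac{w_{x,y}(\omega)}{|x-y|^{d+\alpha}}.$$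 Then for every $\gamma>0$ there exist a (deterministic) constant $C>0$ and a random variable $m^*(\omega)\ge 1$ such that, almost surely, for every integer $m>m^*(\omega)$ the local Poisson equation $$\mathcal L^\omega_{B_{2^m}}\widetilde\phi_m(x)=-V_m(x)+\frac1{|B_{2^m}|}\sum_{y\in B_{2^m}}V_m(y)\quad(x\in B_{2^m}),\qquad \sum_{x\in B_{2^m}}\widetilde\phi_m(x)=0$$ has a unique solution $\widetilde\phi_m:B_{2^m}\to\mathbb R^d$, and $$\mathscr E^\omega_{B_{2^m}}(\widetilde\phi_m,\widetilde\phi_m)\le C\begin{cases} m^{2+\frac{1+\gamma}{(2(d-1))\wedge d}}\,2^{md}, & \alpha=1,\\[1mm] m^{\frac{(1+\gamma)\alpha}{(2(d-\alpha))\wedge d}}\,2^{m(d+2(1-\alpha))}, & \alpha\in(0,1).\end{cases}$$ -/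

import Mathlib

open MeasureTheory ProbabilityTheory

noncomputable section

namespace StableConductance

/-- The lattice `ℤ^d`. -/
abbrev Lat (d : ℕ) : Type := Fin d → ℤ

/-- A lattice point regarded as a vector of `ℝ^d` (with the Euclidean norm). -/
def toE {d : ℕ} (z : Lat d) : EuclideanSpace ℝ (Fin d) :=
  WithLp.toLp 2 fun i => (z i : ℝ)

/-- The Euclidean length `|z|` of a lattice point. -/
def len {d : ℕ} (z : Lat d) : ℝ := ‖toE z‖

/-- The collection of unordered pairs of distinct points of `ℤ^d`. -/
abbrev Edge (d : ℕ) : Type := {e : Sym2 (Lat d) // ¬ e.IsDiag}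

/-- The standing assumption on the random conductances `w_{x,y} = w s(x,y)`, `x ≠ y`: they are
i.i.d., non-negative, of mean one and bounded by a deterministic constant. The symmetry
`w_{x,y} = w_{y,x}` is built in by indexing with unordered pairs; nothing is assumed about the
diagonal values `w s(x,x)`, and they play no role below. -/
structure IsConductance {d : ℕ} {Ω : Type*} [MeasurableSpace Ω] (P : Measure Ω)
    (w : Sym2 (Lat d) → Ω → ℝ) : Prop where
  measurable : ∀ e : Edge d, Measurable (w e)
  indep : iIndepFun (fun e : Edge d => w e) P
  identDistrib : ∀ e e' : Edge d, IdentDistrib (w e) (w e') P P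
  nonneg : ∀ e : Edge d, ∀ᵐ ω ∂P, 0 ≤ w e ω
  mean_one : ∀ e : Edge d, ∫ ω, w e ω ∂P = 1
  bounded : ∃ C₁ : ℝ, 0 < C₁ ∧ ∀ e : Edge d, ∀ᵐ ω ∂P, w e ω ≤ C₁

/-- The box `B_R = (-R, R]^d ∩ ℤ^d`. -/
def box (d R : ℕ) : Finset (Lat d) :=
  Fintype.piFinset fun _ => Finset.Ioc (-(R : ℤ)) (R : ℤ)

/-- The non-zero lattice points with `|z| ≤ R`; see `mem_puncturedBall`. -/
def puncturedBall (d R : ℕ) : Finset (Lat d) :=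
  open Classical in
  (Fintype.piFinset fun _ => Finset.Icc (-(R : ℤ)) (R : ℤ)).filter
    fun z => z ≠ 0 ∧ len z ≤ R

theorem mem_puncturedBall {d R : ℕ} (z : Lat d) :
    z ∈ puncturedBall d R ↔ z ≠ 0 ∧ len z ≤ R := by
  unfold puncturedBall
  simp only [Finset.mem_filter, Fintype.mem_piFinset, Finset.mem_Icc, and_iff_right_iff_imp]
  rintro ⟨-, h⟩ i
  have h1 : ‖toE z i‖ ≤ (R : ℝ) := (PiLp.norm_apply_le (toE z) i).trans h
  have h2 : |(z i : ℝ)| ≤ (R : ℝ) := h1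
  rw [abs_le] at h2
  exact ⟨by exact_mod_cast h2.1, by exact_mod_cast h2.2⟩

section Deterministic

variable {d : ℕ} (α : ℝ) (c : Sym2 (Lat d) → ℝ)

/-- The jump kernel `c_{x,y} / |x - y|^{d + α}` for a realization `c` of the conductances. -/
def kernel (x y : Lat d) : ℝ := c s(x, y) / len (x - y) ^ ((d : ℝ) + α)

/-- The operator `L_U f(x) = ∑_{y ∈ U, y ≠ x} (f(y) - f(x)) c_{x,y} / |x - y|^{d + α}`. -/
def genOn (U : Finset (Lat d)) (f : U → EuclideanSpace ℝ (Fin d)) (x : U) :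
    EuclideanSpace ℝ (Fin d) :=
  ∑ y ∈ Finset.univ.erase x, kernel α c x y • (f y - f x)

/-- The energy
`E_U(f,f) = 1/2 ∑_i ∑_{x,y ∈ U, x ≠ y} (f_i(x) - f_i(y))² c_{x,y} / |x - y|^{d + α}`. -/
def energyOn (U : Finset (Lat d)) (f : U → EuclideanSpace ℝ (Fin d)) : ℝ :=
  (1 / 2) * ∑ i : Fin d, ∑ x : U, ∑ y ∈ Finset.univ.erase x,
    (f x i - f y i) ^ 2 * kernel α c x y

/-- The average of `f` over `U`. -/
def avg (U : Finset (Lat d)) (f : U → EuclideanSpace ℝ (Fin d)) : EuclideanSpace ℝ (Fin d) :=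
  (U.card : ℝ)⁻¹ • ∑ x : U, f x

/-- The truncated drift `V_m(x) = ∑_{|z| ≤ 2^m} z / |z|^{d + α} c_{x,x+z}` (the term `z = 0` is
zero and left out). -/
def drift (m : ℕ) (x : Lat d) : EuclideanSpace ℝ (Fin d) :=
  ∑ z ∈ puncturedBall d (2 ^ m), (c s(x, x + z) / len z ^ ((d : ℝ) + α)) • toE z

/-- `φ` solves the local Poisson equation on `B_{2^m}` with the truncated drift:
`L_{B_{2^m}} φ = -V_m + ⨍_{B_{2^m}} V_m` on `B_{2^m}` and `∑_{B_{2^m}} φ = 0`. -/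
def IsCorrector (m : ℕ) (φ : box d (2 ^ m) → EuclideanSpace ℝ (Fin d)) : Prop :=
  (∀ x : box d (2 ^ m), genOn α c (box d (2 ^ m)) φ x =
      -drift α c m x + avg (box d (2 ^ m)) (fun y => drift α c m y)) ∧
    ∑ x, φ x = 0

end Deterministic

/-- The order of the energy bound. -/
def energyRate (d : ℕ) (α γ : ℝ) (m : ℕ) : ℝ :=
  if α = 1 then
    (m : ℝ) ^ (2 + (1 + γ) / min (2 * ((d : ℝ) - 1)) (d : ℝ)) * (2 : ℝ) ^ ((m : ℝ) * d)
  else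
    (m : ℝ) ^ ((1 + γ) * α / min (2 * ((d : ℝ) - α)) (d : ℝ)) *
      (2 : ℝ) ^ ((m : ℝ) * (d + 2 * (1 - α)))

end StableConductance

end

/-! Testing the equation against φ, which has mean zero, gives E(φ,φ) = ∑ V_m·φ. Let A_k be
averaging over the dyadic cubes of side 2^k that tile the box. Since A_{m+1}φ = 0, each coordinate
of the pairing telescopes (`sum_mul_eq_multiscale`) into ∑ V(φ − A_{k₀}φ) + ∑_{k₀≤k≤m} ∑ (A_k V)(φ −
A_{k+1}φ). The φ-factors are bounded by a Poincaré inequality, the V-factors by their size or their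
variance, and Young's inequality absorbs the energy (`dirichlet_le_of_poincare`).

Poincaré: the conductances may vanish, but in a cube Q with at least Λm points any two points x, y
satisfy ∑_z w_{xz}w_{zy} ≥ |Q|/4, outside an event of probability O(e^{-m})
(`measure_not_hasCommonNeighbours_le_exp`). Routing differences through common neighbours gives the
constant κ2^{αk} at scale k (`poincare_of_hasCommonNeighbours`). The first such scale k₀ has 2^{αk₀}
≲ m^{α/d}.

Drift: write S_m = ∑_{0<|z|≤2^m} |z|^{1-d-α}, of order at most m for α = 1 and 2^{(1-α)m} for α < 1.
At scale k₀ only |V| ≤ C S_m is used, which yields m^{α/d} S_m² 2^{md}. At larger scales V is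
centred because z/|z|^{d+α} is odd, so A_k V has variance O(S_m 2^{-kd}). As α < d this beats
2^{αk}, and the weighted sum over all scales has mean O(2^{md} S_m)
(`integral_driftFluctuation_le`). Markov's inequality at level m^{1+1/d} and Borel–Cantelli
conclude; both contributions fit the stated rate, since min(2(d−α), d) ≤ d. -/

noncomputable section

namespace StableConductance

open Finset

/-! ### Averages over nested partitions -/

section CellAverage

variable {X ι : Type*} [Fintype X] [DecidableEq ι]

/-- The class of `x` in the partition of `X` into the fibres of `c`. -/
def cellOf (c : X → ι) (x : X) : Finset X := {y | c y = c x}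

/-- The average of `g` over the fibre of `c` through `x`. -/
def cellAvg (c : X → ι) (g : X → ℝ) (x : X) : ℝ :=
  ((cellOf c x).card : ℝ)⁻¹ * ∑ y ∈ cellOf c x, g y

theorem mem_cellOf {c : X → ι} {x y : X} : y ∈ cellOf c x ↔ c y = c x := by
  simp [cellOf]

theorem cellOf_congr {c : X → ι} {x y : X} (h : c y = c x) : cellOf c y = cellOf c x := by
  ext z; simp [mem_cellOf, h]

theorem cellOf_card_pos (c : X → ι) (x : X) : 0 < ((cellOf c x).card : ℝ) := by
  exact_mod_cast card_pos.2 ⟨x, mem_cellOf.2 rfl⟩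

theorem sum_cellOf_comm (c : X → ι) (F : X → X → ℝ) :
    ∑ x, ∑ y ∈ cellOf c x, F x y = ∑ x, ∑ y ∈ cellOf c x, F y x := by
  simp only [cellOf, sum_filter]
  rw [sum_comm]
  simp only [eq_comm]

/-- The averaging kernel, 1/|cell| on pairs in a common cell, is symmetric. -/
theorem sum_cellAvg_mul (c : X → ι) (g h : X → ℝ) :
    ∑ x, cellAvg c g x * h x = ∑ x, g x * cellAvg c h x := by
  have e1 : ∀ x, cellAvg c g x * h x =
      ∑ y ∈ cellOf c x, ((cellOf c x).card : ℝ)⁻¹ * g y * h x := fun x => by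
    rw [cellAvg, mul_sum, sum_mul]
  have e2 : ∀ x, g x * cellAvg c h x =
      ∑ y ∈ cellOf c x, ((cellOf c y).card : ℝ)⁻¹ * g x * h y := fun x => by
    rw [cellAvg, mul_sum, mul_sum]
    refine sum_congr rfl fun y hy => ?_
    rw [cellOf_congr (mem_cellOf.1 hy)]; ring
  simp only [e1, e2]
  exact sum_cellOf_comm c fun x y => ((cellOf c x).card : ℝ)⁻¹ * g y * h x

theorem cellAvg_congr {c : X → ι} (g : X → ℝ) {x y : X} (h : c y = c x) :
    cellAvg c g y = cellAvg c g x := by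
  rw [cellAvg, cellAvg, cellOf_congr h]

theorem cellAvg_cellAvg_of_le {c c' : X → ι} (hc : ∀ x y, c x = c y → c' x = c' y) (g : X → ℝ)
    (x : X) : cellAvg c (cellAvg c' g) x = cellAvg c' g x := by
  have h : ∑ y ∈ cellOf c x, cellAvg c' g y = ∑ y ∈ cellOf c x, cellAvg c' g x :=
    sum_congr rfl fun y hy => cellAvg_congr g (hc _ _ (mem_cellOf.1 hy))
  rw [cellAvg, h, sum_const, nsmul_eq_mul, ← mul_assoc,
    inv_mul_cancel₀ (cellOf_card_pos c x).ne', one_mul]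

theorem cellAvg_sub (c : X → ι) (f g : X → ℝ) (x : X) :
    cellAvg c (fun y => f y - g y) x = cellAvg c f x - cellAvg c g x := by
  simp [cellAvg, sum_sub_distrib, mul_sub]

/-- Multiscale decomposition of a pairing along a nested sequence of partitions. -/
theorem sum_mul_eq_multiscale (c : ℕ → X → ι)
    (hc : ∀ k x y, c k x = c k y → c (k + 1) x = c (k + 1) y) (g f : X → ℝ) {a b : ℕ}
    (hab : a ≤ b) :
    ∑ x, g x * (f x - cellAvg (c b) f x) = ∑ x, g x * (f x - cellAvg (c a) f x) +
      ∑ k ∈ Ico a b, ∑ x, cellAvg (c k) g x * (f x - cellAvg (c (k + 1)) f x) := by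
  induction b, hab using Nat.le_induction with
  | base => simp
  | succ b hab ih =>
    -- The new term is moved onto f by self-adjointness; it becomes g·(A_b f − A_{b+1} f), because
    -- A_b fixes the coarser average.
    rw [sum_Ico_succ_top hab, ← add_assoc, ← ih, sum_cellAvg_mul, ← sum_add_distrib]
    refine sum_congr rfl fun x _ => ?_
    rw [cellAvg_sub, cellAvg_cellAvg_of_le (hc b)]
    ring

/-- Cauchy–Schwarz, with f x − cellAvg written as the average of f x − f y over the cell; it passes
from variances to complete-graph energies. -/
theorem sum_sub_cellAvg_sq_le (c : X → ι) (f : X → ℝ) :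
    ∑ x, (f x - cellAvg c f x) ^ 2 ≤
      ∑ x, ((cellOf c x).card : ℝ)⁻¹ * ∑ y ∈ cellOf c x, (f x - f y) ^ 2 := by
  refine sum_le_sum fun x _ => ?_
  have hN := cellOf_card_pos c x
  have h1 : f x - cellAvg c f x =
      ((cellOf c x).card : ℝ)⁻¹ * ∑ y ∈ cellOf c x, (f x - f y) := by
    rw [sum_sub_distrib, sum_const, nsmul_eq_mul, mul_sub, ← mul_assoc,
      inv_mul_cancel₀ hN.ne', one_mul, cellAvg]
  rw [h1, mul_pow, sq (_)⁻¹, mul_assoc]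
  refine mul_le_mul_of_nonneg_left ?_ (inv_nonneg.2 hN.le)
  rw [inv_mul_le_iff₀ hN]
  exact sq_sum_le_card_mul_sum_sq

/-- If in each cell any two points have many common neighbours for the weights `w`, then the
complete-graph energy of the cells is controlled by the weighted one. -/
theorem sum_cellOf_sq_le_of_common_neighbours (c : X → ι) (w : X → X → ℝ) {N C : ℝ} (hC : 0 ≤ C)
    (hN : 0 < N) (hcard : ∀ x, ((cellOf c x).card : ℝ) = N) (hw0 : ∀ x y, 0 ≤ w x y)
    (hwC : ∀ x y, w x y ≤ C) (hsymm : ∀ x y, w x y = w y x)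
    (hcn : ∀ x y, x ≠ y → c y = c x → N / 4 ≤ ∑ z ∈ cellOf c x, w x z * w z y) (f : X → ℝ) :
    ∑ x, ∑ y ∈ cellOf c x, (f x - f y) ^ 2 ≤
      16 * C * ∑ x, ∑ y ∈ cellOf c x, w x y * (f x - f y) ^ 2 := by
  set D : X → ℝ := fun x => ∑ z ∈ cellOf c x, w x z * (f x - f z) ^ 2 with hD
  -- Route f x − f y through each common neighbour z; of the two weights w x z and w z y, one is
  -- kept and the other is bounded by C.
  have key : ∀ x, ∀ y ∈ cellOf c x, N / 4 * (f x - f y) ^ 2 ≤ 2 * C * (D x + D y) := by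
    intro x y hy
    have hyx := mem_cellOf.1 hy
    have hDnn : ∀ x, 0 ≤ D x := fun x =>
      sum_nonneg fun z _ => mul_nonneg (hw0 _ _) (sq_nonneg _)
    rcases eq_or_ne x y with rfl | hne
    · have := hDnn x
      simp only [sub_self, ne_eq, OfNat.ofNat_ne_zero, not_false_eq_true, zero_pow, mul_zero]
      positivity
    calc N / 4 * (f x - f y) ^ 2
        ≤ (∑ z ∈ cellOf c x, w x z * w z y) * (f x - f y) ^ 2 :=
          mul_le_mul_of_nonneg_right (hcn x y hne hyx) (sq_nonneg _)
      _ = ∑ z ∈ cellOf c x, w x z * w z y * (f x - f y) ^ 2 := by rw [sum_mul]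
      _ ≤ ∑ z ∈ cellOf c x, 2 * C * (w x z * (f x - f z) ^ 2 + w y z * (f y - f z) ^ 2) := by
          refine sum_le_sum fun z _ => ?_
          have h1 : (f x - f y) ^ 2 ≤ 2 * (f x - f z) ^ 2 + 2 * (f y - f z) ^ 2 := by
            nlinarith [sq_nonneg (f x - f z + (f y - f z))]
          have a1 := hw0 x z
          have a2 := hw0 y z
          have b1 := hwC x z
          have b2 := hwC y z
          rw [hsymm z y]
          calc w x z * w y z * (f x - f y) ^ 2
              ≤ w x z * w y z * (2 * (f x - f z) ^ 2 + 2 * (f y - f z) ^ 2) := by gcongr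
            _ = 2 * (w y z * (w x z * (f x - f z) ^ 2)) +
                2 * (w x z * (w y z * (f y - f z) ^ 2)) := by ring
            _ ≤ 2 * (C * (w x z * (f x - f z) ^ 2)) +
                2 * (C * (w y z * (f y - f z) ^ 2)) := by gcongr
            _ = _ := by ring
      _ = 2 * C * (D x + D y) := by
          rw [← mul_sum, sum_add_distrib]
          simp only [hD]
          rw [cellOf_congr hyx]
  have h2 : N / 4 * ∑ x, ∑ y ∈ cellOf c x, (f x - f y) ^ 2 ≤ N * (4 * C * ∑ x, D x) := by
    calc N / 4 * ∑ x, ∑ y ∈ cellOf c x, (f x - f y) ^ 2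
        = ∑ x, ∑ y ∈ cellOf c x, N / 4 * (f x - f y) ^ 2 := by simp only [mul_sum]
      _ ≤ ∑ x, ∑ y ∈ cellOf c x, 2 * C * (D x + D y) :=
          sum_le_sum fun x _ => sum_le_sum fun y hy => key x y hy
      _ = 2 * C * (∑ x, ∑ y ∈ cellOf c x, D x + ∑ x, ∑ y ∈ cellOf c x, D y) := by
          simp only [← mul_sum, ← sum_add_distrib]
      _ = 2 * C * (∑ x, ∑ y ∈ cellOf c x, D x + ∑ x, ∑ y ∈ cellOf c x, D x) := by
          rw [sum_cellOf_comm c fun x y => D y]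
      _ = N * (4 * C * ∑ x, D x) := by
          have : ∑ x, ∑ y ∈ cellOf c x, D x = N * ∑ x, D x := by
            rw [mul_sum]
            exact sum_congr rfl fun x _ => by rw [sum_const, nsmul_eq_mul, hcard]
          rw [this]; ring
  have h3 : N * ((∑ x, ∑ y ∈ cellOf c x, (f x - f y) ^ 2) / 4) ≤ N * (4 * C * ∑ x, D x) := by
    linarith
  have h4 := le_of_mul_le_mul_left h3 hN
  linarith

end CellAverage

/-! ### Dirichlet forms, the Poisson equation and the multiscale energy bound -/

section Energy

variable {X : Type*} [Fintype X]

/-- The Dirichlet form of a kernel on a finite set. -/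
def dirichlet (K : X → X → ℝ) (f : X → ℝ) : ℝ :=
  (1 / 2) * ∑ x, ∑ y, K x y * (f x - f y) ^ 2

/-- The generator of a kernel on a finite set. -/
def generator (K : X → X → ℝ) : (X → ℝ) →ₗ[ℝ] (X → ℝ) where
  toFun f x := ∑ y, K x y * (f y - f x)
  map_add' f g := by
    ext x
    simp only [Pi.add_apply, ← sum_add_distrib]
    exact sum_congr rfl fun y _ => by ring
  map_smul' r f := by
    ext x
    simp only [Pi.smul_apply, smul_eq_mul, RingHom.id_apply, mul_sum]
    exact sum_congr rfl fun y _ => by ring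

theorem generator_apply (K : X → X → ℝ) (f : X → ℝ) (x : X) :
    generator K f x = ∑ y, K x y * (f y - f x) := rfl

theorem sum_generator_mul {K : X → X → ℝ} (hK : ∀ x y, K x y = K y x) (f : X → ℝ) :
    ∑ x, generator K f x * f x = -dirichlet K f := by
  have h1 : ∑ x, generator K f x * f x = ∑ x, ∑ y, K x y * (f y - f x) * f x := by
    simp only [generator_apply, sum_mul]
  have h2 : ∑ x, ∑ y, K x y * (f y - f x) * f x = ∑ x, ∑ y, K x y * (f x - f y) * f y := by
    rw [sum_comm]
    exact sum_congr rfl fun x _ => sum_congr rfl fun y _ => by rw [hK]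
  have h3 : ∑ x, ∑ y, K x y * (f y - f x) * f x + ∑ x, ∑ y, K x y * (f x - f y) * f y =
      -∑ x, ∑ y, K x y * (f x - f y) ^ 2 := by
    simp only [← sum_add_distrib, ← sum_neg_distrib]
    exact sum_congr rfl fun x _ => sum_congr rfl fun y _ => by ring
  rw [h1, dirichlet]
  linarith

theorem sum_generator {K : X → X → ℝ} (hK : ∀ x y, K x y = K y x) (f : X → ℝ) :
    ∑ x, generator K f x = 0 := by
  have h2 : ∑ x, ∑ y, K x y * (f y - f x) = ∑ x, ∑ y, K x y * (f x - f y) := by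
    rw [sum_comm]
    exact sum_congr rfl fun x _ => sum_congr rfl fun y _ => by rw [hK]
  have h3 : ∑ x, ∑ y, K x y * (f y - f x) + ∑ x, ∑ y, K x y * (f x - f y) = 0 := by
    simp only [← sum_add_distrib]
    exact sum_eq_zero fun x _ => sum_eq_zero fun y _ => by ring
  simp only [generator_apply]
  linarith

/-- Solvability of the Poisson equation on a finite set on which only constants have zero
energy. -/
theorem existsUnique_generator_eq [Nonempty X] {K : X → X → ℝ} (hK : ∀ x y, K x y = K y x)
    (h0 : ∀ f : X → ℝ, dirichlet K f = 0 → ∑ x, f x = 0 → f = 0) {g : X → ℝ}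
    (hg : ∑ x, g x = 0) : ∃! f : X → ℝ, generator K f = g ∧ ∑ x, f x = 0 := by
  -- The added rank-one term removes the kernel of constants. Since the generator has image of sum
  -- zero, T f = g with ∑ g = 0 still forces ∑ f = 0.
  let T : (X → ℝ) →ₗ[ℝ] (X → ℝ) :=
    { toFun := fun f x => generator K f x + ∑ y, f y
      map_add' := fun f h => by ext x; simp [sum_add_distrib]; ring
      map_smul' := fun r f => by ext x; simp [mul_sum, mul_add] }
  have hT : ∀ f x, T f x = generator K f x + ∑ y, f y := fun f x => rfl
  have hsum : ∀ f, ∑ x, T f x = 0 → ∑ x, f x = 0 := by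
    intro f hf
    simp only [hT, sum_add_distrib, sum_generator hK, zero_add, sum_const, nsmul_eq_mul,
      mul_eq_zero] at hf
    refine hf.resolve_left ?_
    simp
  have hinj : Function.Injective T := by
    rw [← LinearMap.ker_eq_bot, LinearMap.ker_eq_bot']
    intro f hf
    have hs := hsum f (by simp [hf])
    refine h0 f ?_ hs
    have hgen : ∀ x, generator K f x = 0 := fun x => by
      have := hT f x
      rw [hf, hs] at this
      simpa using this.symm
    have := sum_generator_mul hK f
    simp only [hgen, zero_mul, sum_const_zero] at this
    linarith
  obtain ⟨f, hf⟩ := LinearMap.injective_iff_surjective.1 hinj g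
  have hs := hsum f (by rw [hf]; exact hg)
  refine ⟨f, ⟨?_, hs⟩, ?_⟩
  · ext x
    rw [← hf, hT, hs, add_zero]
  · rintro f' ⟨h1, h2⟩
    refine hinj ?_
    ext x
    rw [hf, hT, h1, h2, add_zero]

/-- Energy estimate for the Poisson equation from Poincaré inequalities at all scales between `a`
and `b`. -/
theorem dirichlet_le_of_poincare {ι : Type*} [DecidableEq ι] (c : ℕ → X → ι)
    (hc : ∀ k x y, c k x = c k y → c (k + 1) x = c (k + 1) y) {g f : X → ℝ} {a b : ℕ}
    (hab : a ≤ b) (htop : ∀ x, cellAvg (c b) f x = 0) {E : ℝ} (hE0 : 0 ≤ E)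
    (hE : E = ∑ x, g x * f x) {p t : ℕ → ℝ} (ht : ∀ k, 0 < t k) {t₀ : ℝ} (ht₀ : 0 < t₀)
    (hP : ∀ k ∈ Icc a b, ∑ x, (f x - cellAvg (c k) f x) ^ 2 ≤ p k * E)
    (hp : p a / t₀ + ∑ k ∈ Ico a b, p (k + 1) / t k ≤ 1) :
    E ≤ t₀ * ∑ x, g x ^ 2 + ∑ k ∈ Ico a b, t k * ∑ x, cellAvg (c k) g x ^ 2 := by
  have young : ∀ (u v : X → ℝ) (s q : ℝ), 0 < s → ∑ x, v x ^ 2 ≤ q * E →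
      ∑ x, u x * v x ≤ s / 2 * ∑ x, u x ^ 2 + q / s * E / 2 := by
    intro u v s q hs hq
    have h1 : ∀ x, u x * v x ≤ s / 2 * u x ^ 2 + (2 * s)⁻¹ * v x ^ 2 := by
      intro x
      have h : s / 2 * u x ^ 2 + (2 * s)⁻¹ * v x ^ 2 - u x * v x =
          (2 * s)⁻¹ * (s * u x - v x) ^ 2 := by field_simp; ring
      have : 0 ≤ (2 * s)⁻¹ * (s * u x - v x) ^ 2 := by positivity
      linarith
    calc ∑ x, u x * v x ≤ ∑ x, (s / 2 * u x ^ 2 + (2 * s)⁻¹ * v x ^ 2) :=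
          sum_le_sum fun x _ => h1 x
      _ = s / 2 * ∑ x, u x ^ 2 + (2 * s)⁻¹ * ∑ x, v x ^ 2 := by
          rw [sum_add_distrib, mul_sum, mul_sum]
      _ ≤ s / 2 * ∑ x, u x ^ 2 + (2 * s)⁻¹ * (q * E) := by gcongr
      _ = _ := by field_simp
  have hfirst := young g (fun x => f x - cellAvg (c a) f x) t₀ (p a) ht₀
    (hP a (left_mem_Icc.2 hab))
  have hrest : ∑ k ∈ Ico a b, ∑ x, cellAvg (c k) g x * (f x - cellAvg (c (k + 1)) f x) ≤
      ∑ k ∈ Ico a b, (t k / 2 * ∑ x, cellAvg (c k) g x ^ 2 + p (k + 1) / t k * E / 2) := by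
    refine sum_le_sum fun k hk => young (cellAvg (c k) g)
      (fun x => f x - cellAvg (c (k + 1)) f x) (t k) (p (k + 1)) (ht k) (hP _ ?_)
    have := mem_Ico.1 hk
    exact mem_Icc.2 ⟨by lia, by lia⟩
  have hdec := sum_mul_eq_multiscale c hc g f hab
  simp only [htop, sub_zero] at hdec
  have hsplit : ∑ k ∈ Ico a b, (t k / 2 * ∑ x, cellAvg (c k) g x ^ 2 + p (k + 1) / t k * E / 2) =
      (∑ k ∈ Ico a b, t k * ∑ x, cellAvg (c k) g x ^ 2) / 2 +
        (∑ k ∈ Ico a b, p (k + 1) / t k) * E / 2 := by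
    rw [sum_add_distrib, sum_mul, sum_div, sum_div]
    congr 1
    exact sum_congr rfl fun k _ => by ring
  -- By `hp` the energy terms from Young's inequality total at most E/2 and are absorbed on the
  -- left; the remaining factor 1/2 then cancels.
  have hlast := mul_le_mul_of_nonneg_right hp hE0
  rw [hsplit] at hrest
  rw [← hE] at hdec
  nlinarith

end Energy

/-! ### Dyadic cubes and the mass of the drift kernel -/

section Lattice

variable {d : ℕ}

theorem toE_apply (z : Lat d) (i : Fin d) : toE z i = z i := rfl

theorem abs_apply_le_len (z : Lat d) (i : Fin d) : |(z i : ℝ)| ≤ len z :=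
  PiLp.norm_apply_le (toE z) i

theorem len_neg (z : Lat d) : len (-z) = len z := by
  have : toE (-z) = -toE z := by ext i; simp [toE_apply]
  rw [len, this, norm_neg, len]

theorem len_nonneg (z : Lat d) : 0 ≤ len z := norm_nonneg _

theorem one_le_len {z : Lat d} (hz : z ≠ 0) : 1 ≤ len z := by
  obtain ⟨i, hi⟩ := Function.ne_iff.1 hz
  refine le_trans ?_ (abs_apply_le_len z i)
  have : (1 : ℤ) ≤ |z i| := Int.one_le_abs hi
  exact_mod_cast this

theorem len_le_of_abs_le {z : Lat d} {r : ℝ} (hr : 0 ≤ r) (h : ∀ i, |(z i : ℝ)| ≤ r) :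
    len z ≤ Real.sqrt d * r := by
  rw [len, EuclideanSpace.norm_eq, ← Real.sqrt_sq hr, ← Real.sqrt_mul (by positivity)]
  refine Real.sqrt_le_sqrt ?_
  calc ∑ i, ‖toE z i‖ ^ 2 ≤ ∑ _i : Fin d, r ^ 2 := by
        refine sum_le_sum fun i _ => ?_
        have := h i
        rw [toE_apply, Real.norm_eq_abs]
        gcongr
    _ = d * r ^ 2 := by simp

/-- The index of the dyadic cube of side `2 ^ k` containing `x`; the cubes are positioned so that
they tile the box `B_{2^m}`. -/
def dyadicIndex (m k : ℕ) (x : Lat d) : Lat d := fun i => (x i + 2 ^ m - 1) / 2 ^ k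

theorem dyadicIndex_succ {m k : ℕ} {x y : Lat d} (h : dyadicIndex m k x = dyadicIndex m k y) :
    dyadicIndex m (k + 1) x = dyadicIndex m (k + 1) y := by
  ext i
  have := congrFun h i
  simp only [dyadicIndex] at this ⊢
  rw [pow_succ, ← Int.ediv_ediv_of_nonneg (by positivity),
    ← Int.ediv_ediv_of_nonneg (by positivity), this]

/-- The points of `B_{2^m}` in the dyadic cube of side `2 ^ k` containing `x`. -/
def dyadicCube (m k : ℕ) (x : Lat d) : Finset (Lat d) :=
  {y ∈ box d (2 ^ m) | dyadicIndex m k y = dyadicIndex m k x}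

theorem mem_box {m : ℕ} {x : Lat d} :
    x ∈ box d (2 ^ m) ↔ ∀ i, -(2 ^ m : ℤ) < x i ∧ x i ≤ 2 ^ m := by
  simp [box]

theorem card_box (m : ℕ) : (box d (2 ^ m)).card = 2 ^ ((m + 1) * d) := by
  rw [box, Fintype.card_piFinset]
  simp only [Int.card_Ioc, prod_const, card_univ, Fintype.card_fin]
  rw [pow_mul]
  congr 1
  push_cast
  ring_nf
  norm_cast

theorem dyadicIndex_top {m : ℕ} {x : Lat d} (hx : x ∈ box d (2 ^ m)) :
    dyadicIndex m (m + 1) x = 0 := by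
  ext i
  have := mem_box.1 hx i
  rw [dyadicIndex]
  refine Int.ediv_eq_zero_of_lt (by lia) ?_
  rw [pow_succ]
  lia

/-- The box has side 2^{m+1}, a multiple of 2^k, so no dyadic cube meeting it sticks out. Hence all
cells of one scale have the same cardinality. -/
theorem dyadicCube_eq {m k : ℕ} (hk : k ≤ m + 1) {x : Lat d} (hx : x ∈ box d (2 ^ m)) :
    dyadicCube m k x = Fintype.piFinset fun i =>
      Ico (dyadicIndex m k x i * 2 ^ k - 2 ^ m + 1)
        (dyadicIndex m k x i * 2 ^ k - 2 ^ m + 1 + 2 ^ k) := by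
  have h2k : (0 : ℤ) < 2 ^ k := by positivity
  ext y
  simp only [dyadicCube, mem_filter, mem_box, Fintype.mem_piFinset, mem_Ico]
  have key : ∀ i, dyadicIndex m k y i = dyadicIndex m k x i ↔
      dyadicIndex m k x i * 2 ^ k - 2 ^ m + 1 ≤ y i ∧
        y i < dyadicIndex m k x i * 2 ^ k - 2 ^ m + 1 + 2 ^ k := by
    intro i
    rw [dyadicIndex, Int.ediv_eq_iff_of_pos h2k]
    constructor <;> rintro ⟨h1, h2⟩ <;> constructor <;> linarith
  constructor
  · rintro ⟨-, h⟩ i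
    exact (key i).1 (congrFun h i)
  · intro h
    refine ⟨fun i => ?_, funext fun i => (key i).2 (h i)⟩
    obtain ⟨h1, h2⟩ := h i
    obtain ⟨x1, x2⟩ := mem_box.1 hx i
    have q0 : 0 ≤ dyadicIndex m k x i := Int.ediv_nonneg (by lia) h2k.le
    obtain ⟨j, hj⟩ := Nat.exists_eq_add_of_le hk
    have q1 : dyadicIndex m k x i < 2 ^ j := by
      refine Int.ediv_lt_of_lt_mul h2k ?_
      have : (2 : ℤ) ^ j * 2 ^ k = 2 * 2 ^ m := by
        rw [← pow_add, add_comm j k, ← hj, pow_succ, mul_comm]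
      lia
    have q2 : (dyadicIndex m k x i + 1) * 2 ^ k ≤ 2 * 2 ^ m := by
      have : (2 : ℤ) ^ j * 2 ^ k = 2 * 2 ^ m := by
        rw [← pow_add, add_comm j k, ← hj, pow_succ, mul_comm]
      rw [← this]
      exact mul_le_mul_of_nonneg_right (by lia) h2k.le
    have q3 : 0 ≤ dyadicIndex m k x i * 2 ^ k := by positivity
    constructor <;> linarith

theorem card_dyadicCube {m k : ℕ} (hk : k ≤ m + 1) {x : Lat d} (hx : x ∈ box d (2 ^ m)) :
    (dyadicCube m k x).card = 2 ^ (k * d) := by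
  rw [dyadicCube_eq hk hx, Fintype.card_piFinset]
  simp only [Int.card_Ico, add_sub_cancel_left, prod_const, card_univ, Fintype.card_fin]
  rw [pow_mul]
  congr 1

/-- The dyadic cube index as a function on the box `B_{2^m}`. -/
def boxIndex (m k : ℕ) (x : box d (2 ^ m)) : Lat d := dyadicIndex m k x.1

theorem map_cellOf (m k : ℕ) (x : box d (2 ^ m)) :
    (cellOf (boxIndex m k) x).map
      (Function.Embedding.subtype (· ∈ box d (2 ^ m))) = dyadicCube m k x := by
  ext y
  simp [mem_cellOf, dyadicCube, boxIndex, and_comm]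

theorem card_cellOf {m k : ℕ} (hk : k ≤ m + 1) (x : box d (2 ^ m)) :
    (cellOf (boxIndex m k) x).card = 2 ^ (k * d) := by
  rw [← card_dyadicCube hk x.2, ← map_cellOf, card_map]

theorem sum_cellOf {m k : ℕ} (x : box d (2 ^ m)) (F : Lat d → ℝ) :
    ∑ y ∈ cellOf (boxIndex m k) x, F y =
      ∑ y ∈ dyadicCube m k x, F y := by
  rw [← map_cellOf, sum_map]
  rfl

theorem cellOf_top (m : ℕ) (x : box d (2 ^ m)) :
    cellOf (boxIndex m (m + 1)) x = univ := by
  ext y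
  simp only [mem_cellOf, mem_univ, iff_true, boxIndex]
  rw [dyadicIndex_top y.2, dyadicIndex_top x.2]

theorem len_sub_le_of_dyadicIndex_eq {m k : ℕ} {x y : Lat d}
    (h : dyadicIndex m k x = dyadicIndex m k y) : len (x - y) ≤ Real.sqrt d * 2 ^ k := by
  refine len_le_of_abs_le (by positivity) fun i => ?_
  have h2k : (0 : ℤ) < 2 ^ k := by positivity
  have h1 := congrFun h i
  simp only [dyadicIndex] at h1
  have a1 := Int.mul_ediv_add_emod (x i + 2 ^ m - 1) (2 ^ k)
  have a2 := Int.mul_ediv_add_emod (y i + 2 ^ m - 1) (2 ^ k)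
  have b1 := Int.emod_nonneg (x i + 2 ^ m - 1) h2k.ne'
  have b2 := Int.emod_nonneg (y i + 2 ^ m - 1) h2k.ne'
  have c1 := Int.emod_lt_of_pos (x i + 2 ^ m - 1) h2k
  have c2 := Int.emod_lt_of_pos (y i + 2 ^ m - 1) h2k
  rw [h1] at a1
  have : |x i - y i| ≤ 2 ^ k := by
    rw [abs_le]
    constructor <;> linarith
  rw [Pi.sub_apply]
  exact_mod_cast this

/-- The total mass `∑_{0 < |z| ≤ 2^m} |z|^{1 - d - α}` bounding the truncated drift. -/
def driftMass (d : ℕ) (α : ℝ) (m : ℕ) : ℝ :=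
  ∑ z ∈ puncturedBall d (2 ^ m), len z ^ (1 - (d : ℝ) - α)

theorem card_puncturedBall_filter_len_lt (m j : ℕ) :
    ({z ∈ puncturedBall d (2 ^ m) | len z < 2 ^ (j + 1)}.card : ℝ) ≤ 8 ^ d * 2 ^ (j * d) := by
  have hsub : {z ∈ puncturedBall d (2 ^ m) | len z < 2 ^ (j + 1)} ⊆
      Fintype.piFinset fun _ : Fin d => Ioc (-(2 ^ (j + 2) : ℤ)) (2 ^ (j + 2)) := by
    intro z hz
    rw [mem_filter] at hz
    refine Fintype.mem_piFinset.2 fun i => mem_Ioc.2 ?_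
    have h1 := (abs_apply_le_len z i).trans_lt hz.2
    have h2 : |z i| < 2 ^ (j + 1) := by exact_mod_cast h1
    rw [abs_lt] at h2
    have h3 : (2 : ℤ) ^ (j + 2) = 2 * 2 ^ (j + 1) := by ring
    have h4 : (0 : ℤ) < 2 ^ (j + 1) := by positivity
    constructor <;> lia
  have h := card_le_card hsub
  rw [Fintype.card_piFinset] at h
  simp only [Int.card_Ioc, prod_const, card_univ, Fintype.card_fin] at h
  have h5 : ((2 : ℤ) ^ (j + 2) - -(2 ^ (j + 2))).toNat = 8 * 2 ^ j := by
    have : (2 : ℤ) ^ (j + 2) - -(2 ^ (j + 2)) = ((8 * 2 ^ j : ℕ) : ℤ) := by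
      push_cast; ring
    rw [this, Int.toNat_natCast]
  rw [h5, mul_pow, ← pow_mul] at h
  exact_mod_cast h

/-- The shell 2^j ≤ |z| < 2^{j+1} has at most 8^d 2^{jd} points, each contributing at most
2^{j(1-d-α)}. -/
theorem driftMass_le_sum {α : ℝ} (hα : 0 < α) (hd : 1 ≤ d) (m : ℕ) :
    driftMass d α m ≤ 8 ^ d * ∑ j ∈ range (m + 1), ((2 : ℝ) ^ (1 - α)) ^ j := by
  have hd' : (1 : ℝ) ≤ d := by exact_mod_cast hd
  have hlog : ∀ z ∈ puncturedBall d (2 ^ m), Nat.log 2 ⌊len z⌋₊ ∈ range (m + 1) := by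
    intro z hz
    have hz' := ((mem_puncturedBall z).1 hz).2
    rw [mem_range, Nat.lt_succ_iff]
    have : ⌊len z⌋₊ ≤ 2 ^ m := Nat.floor_le_of_le hz'
    exact (Nat.log_mono_right this).trans (by rw [Nat.log_pow (by norm_num)])
  rw [driftMass, ← sum_fiberwise_of_maps_to hlog, mul_sum]
  refine sum_le_sum fun j _ => ?_
  have hfl : ∀ z ∈ {z ∈ puncturedBall d (2 ^ m) | Nat.log 2 ⌊len z⌋₊ = j},
      (2 : ℝ) ^ j ≤ len z ∧ len z < 2 ^ (j + 1) := by
    intro z hz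
    rw [mem_filter] at hz
    have h1 := one_le_len ((mem_puncturedBall z).1 hz.1).1
    have h2 : ⌊len z⌋₊ ≠ 0 := (Nat.floor_pos.2 h1).ne'
    constructor
    · have := Nat.pow_log_le_self 2 h2
      rw [hz.2] at this
      have h3 : ((2 ^ j : ℕ) : ℝ) ≤ len z :=
        (Nat.cast_le.2 this).trans (Nat.floor_le (by linarith))
      exact_mod_cast h3
    · have := Nat.lt_pow_succ_log_self (b := 2) (by norm_num) ⌊len z⌋₊
      rw [hz.2, Nat.floor_lt (by linarith)] at this
      exact_mod_cast this
  calc ∑ z ∈ puncturedBall d (2 ^ m) with Nat.log 2 ⌊len z⌋₊ = j, len z ^ (1 - (d : ℝ) - α)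
      ≤ ∑ z ∈ puncturedBall d (2 ^ m) with Nat.log 2 ⌊len z⌋₊ = j,
          ((2 : ℝ) ^ j) ^ (1 - (d : ℝ) - α) :=
        sum_le_sum fun z hz =>
          Real.rpow_le_rpow_of_nonpos (by positivity) (hfl z hz).1 (by linarith)
    _ = ({z ∈ puncturedBall d (2 ^ m) | Nat.log 2 ⌊len z⌋₊ = j}.card : ℝ) *
          ((2 : ℝ) ^ j) ^ (1 - (d : ℝ) - α) := by rw [sum_const, nsmul_eq_mul]
    _ ≤ (8 ^ d * 2 ^ (j * d)) * ((2 : ℝ) ^ j) ^ (1 - (d : ℝ) - α) := by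
        refine mul_le_mul_of_nonneg_right ?_ (by positivity)
        refine le_trans ?_ (card_puncturedBall_filter_len_lt m j)
        exact_mod_cast card_le_card fun z hz =>
          mem_filter.2 ⟨(mem_filter.1 hz).1, (hfl z hz).2⟩
    _ = 8 ^ d * ((2 : ℝ) ^ (1 - α)) ^ j := by
        rw [mul_assoc]
        congr 1
        rw [← Real.rpow_natCast, ← Real.rpow_natCast, ← Real.rpow_natCast,
          ← Real.rpow_mul (by norm_num), ← Real.rpow_mul (by norm_num),
          ← Real.rpow_add (by norm_num)]
        congr 1
        push_cast
        ring

end Lattice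

/-! ### Cancellation and size of the drift -/

section Drift

variable {d : ℕ} {α : ℝ} {c : Sym2 (Lat d) → ℝ}

/-- The coefficient `z_i / |z|^{d + α}` of the drift. -/
def driftCoeff (α : ℝ) (i : Fin d) (z : Lat d) : ℝ := z i / len z ^ ((d : ℝ) + α)

theorem driftCoeff_neg (i : Fin d) (z : Lat d) :
    driftCoeff α i (-z) = -driftCoeff α i z := by
  simp [driftCoeff, len_neg, neg_div]

theorem abs_driftCoeff_le (i : Fin d) {z : Lat d} (hz : z ≠ 0) :
    |driftCoeff α i z| ≤ len z ^ (1 - (d : ℝ) - α) := by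
  have h0 : 0 < len z := zero_lt_one.trans_le (one_le_len hz)
  have h1 : len z ^ (1 - (d : ℝ) - α) = len z / len z ^ ((d : ℝ) + α) := by
    rw [← sub_add_eq_sub_sub, Real.rpow_sub h0, Real.rpow_one]
  rw [driftCoeff, abs_div, abs_of_nonneg (Real.rpow_nonneg h0.le _), h1]
  exact div_le_div_of_nonneg_right (abs_apply_le_len z i) (Real.rpow_nonneg h0.le _)

/-- A deliberately crude bound: coefficients are at most 1, so `driftMass` also controls the
variance. One power of it suffices there, because the small scales already cost its square. -/
theorem driftCoeff_sq_le (hα : 0 < α) (hd : 1 ≤ d) (i : Fin d) {z : Lat d} (hz : z ≠ 0) :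
    driftCoeff α i z ^ 2 ≤ len z ^ (1 - (d : ℝ) - α) := by
  have hd' : (1 : ℝ) ≤ d := by exact_mod_cast hd
  have h1 := abs_driftCoeff_le (α := α) i hz
  have h2 : len z ^ (1 - (d : ℝ) - α) ≤ 1 :=
    Real.rpow_le_one_of_one_le_of_nonpos (one_le_len hz) (by linarith)
  rw [← sq_abs]
  nlinarith [abs_nonneg (driftCoeff α i z)]

theorem drift_apply (m : ℕ) (x : Lat d) (i : Fin d) :
    drift α c m x i = ∑ z ∈ puncturedBall d (2 ^ m), c s(x, x + z) * driftCoeff α i z := by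
  have h : ∀ z : Lat d, ((c s(x, x + z) / len z ^ ((d : ℝ) + α)) • toE z) i =
      c s(x, x + z) * driftCoeff α i z := by
    intro z
    rw [PiLp.smul_apply, toE_apply, driftCoeff, smul_eq_mul]
    ring
  rw [drift, WithLp.ofLp_sum, Finset.sum_apply]
  exact sum_congr rfl fun z _ => h z

theorem sum_driftCoeff (m : ℕ) (i : Fin d) :
    ∑ z ∈ puncturedBall d (2 ^ m), driftCoeff α i z = 0 := by
  have h : ∑ z ∈ puncturedBall d (2 ^ m), driftCoeff α i z =
      ∑ z ∈ puncturedBall d (2 ^ m), -driftCoeff α i z := by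
    refine sum_nbij' (fun z => -z) (fun z => -z) ?_ ?_ ?_ ?_ ?_
    · intro z hz
      simpa [mem_puncturedBall, len_neg] using hz
    · intro z hz
      simpa [mem_puncturedBall, len_neg] using hz
    · simp
    · simp
    · intro z _
      rw [driftCoeff_neg, neg_neg]
  rw [sum_neg_distrib] at h
  linarith

/-- The drift only depends on the centred conductances. -/
theorem drift_apply_eq_centred (m : ℕ) (x : Lat d) (i : Fin d) :
    drift α c m x i = ∑ z ∈ puncturedBall d (2 ^ m), driftCoeff α i z * (c s(x, x + z) - 1) := by
  rw [drift_apply, ← sub_zero (∑ z ∈ _, _), ← sum_driftCoeff (α := α) m i, ← sum_sub_distrib]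
  exact sum_congr rfl fun z _ => by ring

theorem not_isDiag_add {x z : Lat d} (hz : z ≠ 0) : ¬ (s(x, x + z)).IsDiag := by
  simpa using hz

theorem abs_drift_le {C : ℝ} (h0 : ∀ e : Edge d, 0 ≤ c e) (hC : ∀ e : Edge d, c e ≤ C)
    (m : ℕ) (x : Lat d) (i : Fin d) : |drift α c m x i| ≤ C * driftMass d α m := by
  rw [drift_apply, driftMass, mul_sum]
  refine (abs_sum_le_sum_abs _ _).trans (sum_le_sum fun z hz => ?_)
  have hz0 := ((mem_puncturedBall z).1 hz).1
  have a := h0 ⟨_, not_isDiag_add (x := x) hz0⟩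
  have b := hC ⟨_, not_isDiag_add (x := x) hz0⟩
  rw [abs_mul, abs_of_nonneg a]
  exact mul_le_mul b (abs_driftCoeff_le i hz0) (abs_nonneg _) (a.trans b)

end Drift

/-! ### Common neighbours with high probability -/

section Concentration

variable {Ω : Type*} [MeasurableSpace Ω] {P : Measure Ω} [IsProbabilityMeasure P]

/-- Sums of products over disjoint pairs of independent bounded variables of mean one are
sub-Gaussian after centring. -/
theorem hasSubgaussianMGF_sum_one_sub_mul {ι κ : Type*} {f : κ → Ω → ℝ}
    (hf : ∀ e, Measurable (f e)) (hind : iIndepFun f P) (h1 : ∀ e, ∫ ω, f e ω ∂P = 1) {C : ℝ}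
    (h0 : ∀ e, ∀ᵐ ω ∂P, 0 ≤ f e ω) (hC : ∀ e, ∀ᵐ ω ∂P, f e ω ≤ C) {u v : ι → κ}
    (hu : u.Injective) (hv : v.Injective) (huv : ∀ i j, u i ≠ v j) (T : Finset ι) :
    HasSubgaussianMGF (fun ω => ∑ i ∈ T, (1 - f (u i) ω * f (v i) ω))
      (∑ _i ∈ T, (‖C ^ 2‖₊ / 2) ^ 2) P := by
  classical
  induction T using Finset.induction_on with
  | empty => simp
  | insert a T ha ih =>
    simp only [sum_insert ha]
    have hone : HasSubgaussianMGF (fun ω => 1 - f (u a) ω * f (v a) ω)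
        ((‖C ^ 2‖₊ / 2) ^ 2) P := by
      have hb : ∀ᵐ ω ∂P, 1 - f (u a) ω * f (v a) ω ∈ Set.Icc (1 - C ^ 2) 1 := by
        filter_upwards [h0 (u a), h0 (v a), hC (u a), hC (v a)] with ω a1 a2 b1 b2
        exact ⟨by nlinarith [mul_le_mul b1 b2 a2 (a1.trans b1)], by nlinarith [mul_nonneg a1 a2]⟩
      have hmul : Integrable (fun ω => f (u a) ω * f (v a) ω) P := by
        refine Integrable.of_mem_Icc 0 (C ^ 2) (by fun_prop) ?_
        filter_upwards [hb] with ω h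
        exact ⟨by linarith [h.2], by linarith [h.1]⟩
      -- Hoeffding's lemma on an interval of length C²; the mean vanishes since the two factors are
      -- independent of mean one.
      have := hasSubgaussianMGF_of_mem_Icc_of_integral_eq_zero
        (X := fun ω => 1 - f (u a) ω * f (v a) ω) (by fun_prop) hb (by
          rw [integral_sub (integrable_const _) hmul,
            (hind.indepFun (huv a a)).integral_fun_mul_eq_mul_integral
              (hf _).aestronglyMeasurable (hf _).aestronglyMeasurable, h1, h1]
          simp)
      simpa using this
    refine hone.add_of_indepFun ih ?_
    have hdisj : Disjoint ({u a, v a} : Finset κ) (T.image u ∪ T.image v) := by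
      rw [Finset.disjoint_left]
      simp only [mem_insert, mem_singleton, mem_union, mem_image, not_or, not_exists, not_and]
      rintro e (rfl | rfl)
      · exact ⟨fun i hi h => ha (hu h ▸ hi), fun i _ h => huv _ _ h.symm⟩
      · exact ⟨fun i _ h => huv _ _ h, fun i hi h => ha (hv h ▸ hi)⟩
    have hI := hind.indepFun_finset _ _ hdisj hf
    have := hI.comp
      (φ := fun g : (({u a, v a} : Finset κ) → ℝ) =>
        1 - g ⟨u a, by simp⟩ * g ⟨v a, by simp⟩)
      (ψ := fun g : ((T.image u ∪ T.image v : Finset κ) → ℝ) =>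
        ∑ i ∈ T.attach, (1 - g ⟨u i, mem_union_left _ (mem_image_of_mem u i.2)⟩ *
          g ⟨v i, mem_union_right _ (mem_image_of_mem v i.2)⟩))
      (by fun_prop) (by fun_prop)
    convert this using 1
    · rfl
    · exact funext fun ω => (sum_attach T fun i => 1 - f (u i) ω * f (v i) ω).symm

/-- The conductance of a realization `c`, set to zero on the diagonal. -/
def offDiag {d : ℕ} (c : Sym2 (Lat d) → ℝ) (x y : Lat d) : ℝ := if x = y then 0 else c s(x, y)

/-- Two points of a finite set have many common neighbours with high probability. -/
theorem measure_common_neighbours_lt_le {d : ℕ} {w : Sym2 (Lat d) → Ω → ℝ}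
    (hw : IsConductance P w) {C : ℝ} (hC0 : 0 < C) (hC : ∀ e : Edge d, ∀ᵐ ω ∂P, w e ω ≤ C)
    (Q : Finset (Lat d)) {x y : Lat d} (hx : x ∈ Q) (hy : y ∈ Q) (hxy : x ≠ y)
    (hQ : 4 ≤ Q.card) :
    P.real {ω | ∑ z ∈ Q, offDiag (fun e => w e ω) x z * offDiag (fun e => w e ω) z y <
      (Q.card : ℝ) / 4} ≤ Real.exp (-(Q.card : ℝ) / (4 * C ^ 4)) := by
  classical
  -- With x and y removed, the edges xz and zy are all distinct, so different z give independent
  -- products.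
  let ι := {z : Lat d // z ≠ x ∧ z ≠ y}
  let u : ι → Edge d := fun z => ⟨s(x, z.1), by simpa using z.2.1.symm⟩
  let v : ι → Edge d := fun z => ⟨s(z.1, y), by simpa using z.2.2⟩
  have hu : u.Injective := by
    intro z z' h
    have h' : s(x, z.1) = s(x, z'.1) := congrArg Subtype.val h
    exact Subtype.ext (Sym2.congr_right.1 h')
  have hv : v.Injective := by
    intro z z' h
    have h' : s(z.1, y) = s(z'.1, y) := congrArg Subtype.val h
    exact Subtype.ext (Sym2.congr_left.1 h')
  have huv : ∀ z z', u z ≠ v z' := by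
    intro z z' h
    have h' : s(x, z.1) = s(z'.1, y) := congrArg Subtype.val h
    rcases Sym2.eq_iff.1 h' with ⟨h1, -⟩ | ⟨h1, -⟩
    · exact z'.2.1 h1.symm
    · exact hxy h1
  set T : Finset ι := Q.subtype _ with hT
  have hTcard : (T.card : ℝ) = Q.card - 2 := by
    have h1 : T.card = ((Q.erase x).erase y).card := by
      rw [hT, card_subtype]
      congr 1
      ext z
      simp only [mem_filter, mem_erase]
      tauto
    rw [h1, card_erase_of_mem (mem_erase.2 ⟨hxy.symm, hy⟩), card_erase_of_mem hx,
      Nat.sub_sub, Nat.cast_sub (by lia)]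
    norm_num
  have hsub := hasSubgaussianMGF_sum_one_sub_mul (f := fun e : Edge d => w e) hw.measurable
    hw.indep hw.mean_one hw.nonneg hC hu hv huv T
  have hQ' : (4 : ℝ) ≤ Q.card := by exact_mod_cast hQ
  -- The mean is |Q| − 2, and losing half of it leaves at least |Q|/4 because |Q| ≥ 4. The same
  -- inequality |T| ≥ |Q|/2 turns the exponent −|T|/(2C⁴) into −|Q|/(4C⁴).
  have hexp := hsub.measure_ge_le (ε := T.card / 2) (by positivity)
  have hsum : ∀ ω, ∑ z ∈ Q, offDiag (fun e => w e ω) x z * offDiag (fun e => w e ω) z y =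
      T.card - ∑ z ∈ T, (1 - w (u z) ω * w (v z) ω) := by
    intro ω
    have h1 : ∑ z ∈ T, w (u z) ω * w (v z) ω =
        ∑ z ∈ Q with (z ≠ x ∧ z ≠ y), w s(x, z) ω * w s(z, y) ω :=
      sum_subtype_eq_sum_filter (s := Q) (p := fun z => z ≠ x ∧ z ≠ y)
        fun z => w s(x, z) ω * w s(z, y) ω
    rw [sum_sub_distrib, sum_const, nsmul_eq_mul, mul_one, sub_sub_cancel, h1, sum_filter]
    refine sum_congr rfl fun z _ => ?_
    unfold offDiag
    by_cases h2 : z = x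
    · simp [h2]
    · by_cases h3 : z = y
      · simp [h3]
      · simp [h2, h3, Ne.symm h2]
  refine (measureReal_mono ?_).trans (hexp.trans ?_)
  · intro ω hω
    simp only [Set.mem_ofPred_eq, hsum] at hω ⊢
    linarith
  · refine Real.exp_le_exp.2 ?_
    have hcoe : ((∑ _i ∈ T, (‖C ^ 2‖₊ / 2) ^ 2 : NNReal) : ℝ) = T.card * (C ^ 4 / 4) := by
      rw [sum_const, nsmul_eq_mul]
      push_cast
      rw [Real.norm_of_nonneg (by positivity)]
      ring
    rw [hcoe]
    have hTpos : (0 : ℝ) < T.card := by linarith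
    have : -((T.card : ℝ) / 2) ^ 2 / (2 * (T.card * (C ^ 4 / 4))) = -T.card / (2 * C ^ 4) := by
      field_simp
      ring
    rw [this, div_le_div_iff₀ (by positivity) (by positivity)]
    have hC4 : 0 < C ^ 4 := by positivity
    nlinarith

end Concentration

/-! ### Variance of sums of the drift -/

section SecondMoment

variable {Ω : Type*} [MeasurableSpace Ω] {P : Measure Ω} [IsProbabilityMeasure P]

/-- Second moment of a linear combination of bounded variables which are uncorrelated unless they
belong to a common class of at most two indices. -/
theorem integral_sq_sum_le {β κ : Type*} [DecidableEq κ] (T : Finset β) (e : β → κ)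
    (X : β → Ω → ℝ) {M : ℝ} (hX : ∀ p ∈ T, AEStronglyMeasurable (X p) P)
    (hM : ∀ p ∈ T, ∀ᵐ ω ∂P, |X p ω| ≤ M)
    (h0 : ∀ p ∈ T, ∀ q ∈ T, e q ≠ e p → ∫ ω, X p ω * X q ω ∂P = 0)
    (hcard : ∀ p ∈ T, #{q ∈ T | e q = e p} ≤ 2) (a : β → ℝ) :
    Integrable (fun ω => (∑ p ∈ T, a p * X p ω) ^ 2) P ∧
      ∫ ω, (∑ p ∈ T, a p * X p ω) ^ 2 ∂P ≤ 2 * M ^ 2 * ∑ p ∈ T, a p ^ 2 := by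
  have hbd : ∀ p ∈ T, ∀ q ∈ T, ∀ᵐ ω ∂P, |X p ω * X q ω| ≤ M ^ 2 := by
    intro p hp q hq
    filter_upwards [hM p hp, hM q hq] with ω h1 h2
    rw [abs_mul, sq]
    exact mul_le_mul h1 h2 (abs_nonneg _) ((abs_nonneg _).trans h1)
  have hint : ∀ p ∈ T, ∀ q ∈ T, Integrable (fun ω => X p ω * X q ω) P := by
    intro p hp q hq
    exact Integrable.of_bound ((hX p hp).mul (hX q hq)) (M ^ 2) (hbd p hp q hq)
  have hexpand : ∀ ω, (∑ p ∈ T, a p * X p ω) ^ 2 =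
      ∑ p ∈ T, ∑ q ∈ T, a p * a q * (X p ω * X q ω) := by
    intro ω
    rw [sq, sum_mul_sum]
    exact sum_congr rfl fun p _ => sum_congr rfl fun q _ => by ring
  simp only [hexpand]
  refine ⟨integrable_finsetSum _ fun p hp => integrable_finsetSum _ fun q hq =>
    (hint p hp q hq).const_mul _, ?_⟩
  rw [integral_finsetSum _ fun p hp => integrable_finsetSum _ fun q hq =>
    (hint p hp q hq).const_mul _]
  -- Only pairs in a common class survive; the inequality 2|ab| ≤ a² + b² reduces them to diagonal
  -- terms, each counted at most twice.
  have hterm : ∀ p ∈ T, ∀ q ∈ T, ∫ ω, a p * a q * (X p ω * X q ω) ∂P ≤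
      if e q = e p then M ^ 2 * (a p ^ 2 / 2 + a q ^ 2 / 2) else 0 := by
    intro p hp q hq
    rw [integral_const_mul]
    split_ifs with h
    · have hle : |∫ ω, X p ω * X q ω ∂P| ≤ M ^ 2 := by
        have := norm_integral_le_of_norm_le_const (μ := P)
          (f := fun ω => X p ω * X q ω) (hbd p hp q hq)
        simpa using this
      have h1 : a p * a q * ∫ ω, X p ω * X q ω ∂P ≤ |a p * a q| * M ^ 2 := by
        refine (le_abs_self _).trans ?_
        rw [abs_mul]
        gcongr
      have h2 : |a p * a q| ≤ a p ^ 2 / 2 + a q ^ 2 / 2 := by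
        rw [abs_le]
        constructor <;> nlinarith [sq_nonneg (a p + a q), sq_nonneg (a p - a q)]
      calc _ ≤ |a p * a q| * M ^ 2 := h1
        _ ≤ (a p ^ 2 / 2 + a q ^ 2 / 2) * M ^ 2 := by gcongr
        _ = _ := mul_comm _ _
    · rw [h0 p hp q hq h, mul_zero]
  have hswap : ∑ p ∈ T, ∑ q ∈ T, (if e q = e p then M ^ 2 * (a q ^ 2 / 2) else 0) =
      ∑ p ∈ T, ∑ q ∈ T, (if e q = e p then M ^ 2 * (a p ^ 2 / 2) else 0) := by
    rw [sum_comm]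
    simp only [eq_comm]
  calc ∑ p ∈ T, ∫ ω, ∑ q ∈ T, a p * a q * (X p ω * X q ω) ∂P
      = ∑ p ∈ T, ∑ q ∈ T, ∫ ω, a p * a q * (X p ω * X q ω) ∂P :=
        sum_congr rfl fun p hp => integral_finsetSum _ fun q hq => (hint p hp q hq).const_mul _
    _ ≤ ∑ p ∈ T, ∑ q ∈ T,
          if e q = e p then M ^ 2 * (a p ^ 2 / 2 + a q ^ 2 / 2) else 0 :=
        sum_le_sum fun p hp => sum_le_sum fun q hq => hterm p hp q hq
    _ = ∑ p ∈ T, ∑ q ∈ T, (if e q = e p then M ^ 2 * (a p ^ 2 / 2) else 0) +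
          ∑ p ∈ T, ∑ q ∈ T, (if e q = e p then M ^ 2 * (a q ^ 2 / 2) else 0) := by
        simp only [← sum_add_distrib]
        refine sum_congr rfl fun p _ => sum_congr rfl fun q _ => ?_
        split_ifs <;> ring
    _ = ∑ p ∈ T, (#{q ∈ T | e q = e p} : ℝ) * (M ^ 2 * a p ^ 2) := by
        rw [hswap, ← sum_add_distrib]
        refine sum_congr rfl fun p _ => ?_
        rw [← sum_filter, sum_const, nsmul_eq_mul]
        ring
    _ ≤ ∑ p ∈ T, 2 * (M ^ 2 * a p ^ 2) := by
        refine sum_le_sum fun p hp => ?_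
        have : (#{q ∈ T | e q = e p} : ℝ) ≤ 2 := by exact_mod_cast hcard p hp
        gcongr
    _ = 2 * M ^ 2 * ∑ p ∈ T, a p ^ 2 := by
        rw [mul_sum]
        exact sum_congr rfl fun p _ => by ring

/-- The drift summed over a finite set has variance of the order of the cardinality. -/
theorem integral_sum_drift_sq_le {d : ℕ} {α : ℝ} (hα : 0 < α) (hd : 1 ≤ d)
    {w : Sym2 (Lat d) → Ω → ℝ} (hw : IsConductance P w) {C : ℝ}
    (hC : ∀ e : Edge d, ∀ᵐ ω ∂P, w e ω ≤ C) (Q : Finset (Lat d)) (m : ℕ) (i : Fin d) :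
    Integrable (fun ω => (∑ x ∈ Q, drift α (fun e => w e ω) m x i) ^ 2) P ∧
      ∫ ω, (∑ x ∈ Q, drift α (fun e => w e ω) m x i) ^ 2 ∂P ≤
        2 * (1 + C) ^ 2 * (Q.card * driftMass d α m) := by
  classical
  have hT : ∀ p ∈ Q ×ˢ puncturedBall d (2 ^ m), p.2 ≠ 0 := fun p hp =>
    ((mem_puncturedBall _).1 (mem_product.1 hp).2).1
  have hnd : ∀ p ∈ Q ×ˢ puncturedBall d (2 ^ m), ¬ (s(p.1, p.1 + p.2)).IsDiag := fun p hp =>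
    not_isDiag_add (hT p hp)
  have hdrift : ∀ ω, ∑ x ∈ Q, drift α (fun e => w e ω) m x i =
      ∑ p ∈ Q ×ˢ puncturedBall d (2 ^ m),
        driftCoeff α i p.2 * (w s(p.1, p.1 + p.2) ω - 1) := by
    intro ω
    rw [sum_product]
    exact sum_congr rfl fun x _ => drift_apply_eq_centred m x i
  have hbd : ∀ e : Edge d, ∀ᵐ ω ∂P, |w e ω - 1| ≤ 1 + C := by
    intro e
    filter_upwards [hw.nonneg e, hC e] with ω h1 h2
    rw [abs_le]
    constructor <;> linarith
  have hint : ∀ e : Edge d, Integrable (w e) P := by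
    intro e
    refine Integrable.of_mem_Icc 0 C (hw.measurable e).aemeasurable ?_
    filter_upwards [hw.nonneg e, hC e] with ω h1 h2 using ⟨h1, h2⟩
  have hmain := integral_sq_sum_le (P := P) (Q ×ˢ puncturedBall d (2 ^ m))
    (fun p => s(p.1, p.1 + p.2)) (fun p ω => w s(p.1, p.1 + p.2) ω - 1) (M := 1 + C)
    (fun p hp => ((hw.measurable ⟨_, hnd p hp⟩).sub_const 1).aestronglyMeasurable)
    (fun p hp => hbd ⟨_, hnd p hp⟩)
    (by
      intro p hp q hq hne
      have hne' : (⟨_, hnd p hp⟩ : Edge d) ≠ ⟨_, hnd q hq⟩ := fun h =>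
        hne (congrArg Subtype.val h).symm
      have hI := (hw.indep.indepFun hne').comp (φ := fun t : ℝ => t - 1)
        (ψ := fun t : ℝ => t - 1) (by fun_prop) (by fun_prop)
      have hz : ∫ ω, (w s(p.1, p.1 + p.2) ω - 1) ∂P = 0 := by
        rw [integral_sub (hint ⟨_, hnd p hp⟩) (integrable_const _), hw.mean_one ⟨_, hnd p hp⟩]
        simp
      have := hI.integral_fun_mul_eq_mul_integral
        ((hw.measurable ⟨_, hnd p hp⟩).sub_const 1).aestronglyMeasurable
        ((hw.measurable ⟨_, hnd q hq⟩).sub_const 1).aestronglyMeasurable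
      simp only [Function.comp_apply] at this
      rw [this, hz, zero_mul])
    (by
      intro p hp
      -- An edge is seen only from its two endpoints, as (x, z) and as (x + z, −z).
      refine (card_le_card (t := {p, (p.1 + p.2, -p.2)}) ?_).trans card_le_two
      intro q hq
      rw [mem_filter] at hq
      rw [mem_insert, mem_singleton]
      rcases Sym2.eq_iff.1 hq.2 with ⟨h1, h2⟩ | ⟨h1, h2⟩
      · left
        rw [h1] at h2
        exact Prod.ext h1 (add_left_cancel h2)
      · right
        refine Prod.ext h1 ?_
        rw [h1] at h2
        rw [eq_neg_iff_add_eq_zero, add_comm]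
        have : p.1 + (p.2 + q.2) = p.1 + 0 := by rw [← add_assoc, h2, add_zero]
        exact add_left_cancel this)
    (fun p => driftCoeff α i p.2)
  simp only [hdrift]
  refine ⟨hmain.1, hmain.2.trans ?_⟩
  refine mul_le_mul_of_nonneg_left ?_ (by positivity)
  rw [sum_product]
  simp only
  rw [sum_const, nsmul_eq_mul, driftMass]
  refine mul_le_mul_of_nonneg_left ?_ (by positivity)
  exact sum_le_sum fun z hz => driftCoeff_sq_le hα hd i ((mem_puncturedBall z).1 hz).1

end SecondMoment

/-! ### The two random inputs: drift fluctuations and common neighbours -/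

section Events

variable {d : ℕ}

/-- The weighted sum over dyadic scales of the squared cell averages of the drift. -/
def driftFluctuation (α : ℝ) (c : Sym2 (Lat d) → ℝ) (m : ℕ) : ℝ :=
  ∑ i : Fin d, ∑ k ∈ range (m + 1), ((2 : ℝ) ^ (((d : ℝ) + α) / 2)) ^ k *
    ∑ x : box d (2 ^ m), cellAvg (boxIndex m k) (fun y => drift α c m y i) x ^ 2

/-- Any two points in a common dyadic cube with at least `r` points have many common
neighbours. -/
def HasCommonNeighbours (c : Sym2 (Lat d) → ℝ) (m : ℕ) (r : ℝ) : Prop :=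
  ∀ k ∈ range (m + 2), r ≤ 2 ^ (k * d) → ∀ x ∈ box d (2 ^ m), ∀ y ∈ dyadicCube m k x, x ≠ y →
    (2 : ℝ) ^ (k * d) / 4 ≤ ∑ z ∈ dyadicCube m k x, offDiag c x z * offDiag c z y

theorem cellAvg_boxIndex {m k : ℕ} (hk : k ≤ m + 1) (F : Lat d → ℝ) (x : box d (2 ^ m)) :
    cellAvg (boxIndex m k) (fun y => F y) x =
      ((2 : ℝ) ^ (k * d))⁻¹ * ∑ y ∈ dyadicCube m k x, F y := by
  rw [cellAvg, card_cellOf hk, sum_cellOf]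
  norm_cast

theorem geom_sum_le {θ : ℝ} (h0 : 0 ≤ θ) (h1 : θ < 1) (s : Finset ℕ) :
    ∑ k ∈ s, θ ^ k ≤ (1 - θ)⁻¹ := by
  rw [← tsum_geometric_of_lt_one h0 h1]
  exact (summable_geometric_of_lt_one h0 h1).sum_le_tsum s fun k _ => by positivity

/-- The weight ρ = 2^{(d+α)/2} is the geometric mean of the Poincaré growth 2^α and the variance
decay factor 2^d. The ratio θ = 2^α/ρ = ρ/2^d therefore governs both the Young terms and the second
moments. -/
theorem scaleRatio_lt_one {α : ℝ} (hd : α < d) : (2 : ℝ) ^ ((α - d) / 2) < 1 :=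
  Real.rpow_lt_one_of_one_lt_of_neg (by norm_num) (by linarith)

theorem driftMass_nonneg (α : ℝ) (m : ℕ) : 0 ≤ driftMass d α m :=
  sum_nonneg fun _ _ => Real.rpow_nonneg (len_nonneg _) _

variable {Ω : Type*} [MeasurableSpace Ω] {P : Measure Ω} [IsProbabilityMeasure P]

/-- Averaging over 2^{kd} points makes the second moment O(2^{-kd} `driftMass`), so the weight ρ^k
leaves the summable factor θ^k. -/
theorem integral_driftFluctuation_le {α : ℝ} (hα : 0 < α) (hd : α < d) (hd1 : 1 ≤ d)
    {w : Sym2 (Lat d) → Ω → ℝ} (hw : IsConductance P w) {C : ℝ}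
    (hC : ∀ e : Edge d, ∀ᵐ ω ∂P, w e ω ≤ C) (m : ℕ) :
    Integrable (fun ω => driftFluctuation α (fun e => w e ω) m) P ∧
      ∫ ω, driftFluctuation α (fun e => w e ω) m ∂P ≤
        d * (1 - (2 : ℝ) ^ ((α - d) / 2))⁻¹ * 2 ^ d * (2 * (1 + C) ^ 2) *
          (2 ^ (m * d) * driftMass d α m) := by
  set ρ : ℝ := (2 : ℝ) ^ (((d : ℝ) + α) / 2) with hρ
  have hρ0 : 0 < ρ := by positivity
  set θ : ℝ := (2 : ℝ) ^ ((α - d) / 2) with hθ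
  have hρθ : ρ = θ * 2 ^ d := by
    rw [hρ, hθ, ← Real.rpow_natCast, ← Real.rpow_add (by norm_num)]
    congr 1
    ring
  have hterm : ∀ (i : Fin d), ∀ k ∈ range (m + 1), ∀ x : box d (2 ^ m),
      Integrable (fun ω =>
        cellAvg (boxIndex m k) (fun y => drift α (fun e => w e ω) m y i) x ^ 2) P ∧
      ρ ^ k * ∫ ω, cellAvg (boxIndex m k) (fun y => drift α (fun e => w e ω) m y i) x ^ 2 ∂P ≤
        θ ^ k * (2 * (1 + C) ^ 2 * driftMass d α m) := by
    intro i k hk x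
    have hk' : k ≤ m + 1 := (mem_range.1 hk).le
    obtain ⟨h1, h2⟩ := integral_sum_drift_sq_le hα hd1 hw hC (dyadicCube m k x.1) m i
    have hfun : ∀ ω, cellAvg (boxIndex m k) (fun y => drift α (fun e => w e ω) m y i) x ^ 2 =
        (((2 : ℝ) ^ (k * d))⁻¹) ^ 2 *
          (∑ y ∈ dyadicCube m k x, drift α (fun e => w e ω) m y i) ^ 2 := by
      intro ω
      rw [cellAvg_boxIndex hk' (fun y => drift α (fun e => w e ω) m y i), mul_pow]
    simp only [hfun]
    refine ⟨h1.const_mul _, ?_⟩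
    rw [integral_const_mul]
    rw [card_dyadicCube hk' x.2] at h2
    push_cast at h2
    have hN : (0 : ℝ) < 2 ^ (k * d) := by positivity
    calc ρ ^ k * ((((2 : ℝ) ^ (k * d))⁻¹) ^ 2 *
          ∫ ω, (∑ y ∈ dyadicCube m k x, drift α (fun e => w e ω) m y i) ^ 2 ∂P)
        ≤ ρ ^ k * ((((2 : ℝ) ^ (k * d))⁻¹) ^ 2 *
          (2 * (1 + C) ^ 2 * (2 ^ (k * d) * driftMass d α m))) := by gcongr
      _ = θ ^ k * (2 * (1 + C) ^ 2 * driftMass d α m) := by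
          rw [hρθ, mul_pow, ← pow_mul, mul_comm d k]
          field_simp
  have hint : ∀ i : Fin d, ∀ k ∈ range (m + 1), Integrable (fun ω => ρ ^ k *
      ∑ x : box d (2 ^ m),
        cellAvg (boxIndex m k) (fun y => drift α (fun e => w e ω) m y i) x ^ 2) P :=
    fun i k hk => (integrable_finsetSum _ fun x _ => (hterm i k hk x).1).const_mul _
  unfold driftFluctuation
  refine ⟨integrable_finsetSum _ fun i _ => integrable_finsetSum _ fun k hk => hint i k hk, ?_⟩
  rw [integral_finsetSum _ fun i _ => integrable_finsetSum _ fun k hk => hint i k hk]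
  have hcardbox : (Fintype.card (box d (2 ^ m)) : ℝ) = 2 ^ d * 2 ^ (m * d) := by
    rw [Fintype.card_coe, card_box, ← pow_add]
    push_cast
    ring
  have hS := driftMass_nonneg (d := d) α m
  calc ∑ i : Fin d, ∫ ω, ∑ k ∈ range (m + 1), ρ ^ k * ∑ x : box d (2 ^ m),
        cellAvg (boxIndex m k) (fun y => drift α (fun e => w e ω) m y i) x ^ 2 ∂P
      = ∑ i : Fin d, ∑ k ∈ range (m + 1), ∑ x : box d (2 ^ m), ρ ^ k *
        ∫ ω, cellAvg (boxIndex m k) (fun y => drift α (fun e => w e ω) m y i) x ^ 2 ∂P := by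
        refine sum_congr rfl fun i _ => ?_
        rw [integral_finsetSum _ fun k hk => hint i k hk]
        refine sum_congr rfl fun k hk => ?_
        rw [integral_const_mul, integral_finsetSum _ fun x _ => (hterm i k hk x).1, mul_sum]
    _ ≤ ∑ i : Fin d, ∑ k ∈ range (m + 1), ∑ x : box d (2 ^ m),
        θ ^ k * (2 * (1 + C) ^ 2 * driftMass d α m) :=
        sum_le_sum fun i _ => sum_le_sum fun k hk => sum_le_sum fun x _ => (hterm i k hk x).2
    _ = (∑ k ∈ range (m + 1), θ ^ k) * (d * 2 ^ d * (2 * (1 + C) ^ 2) *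
          (2 ^ (m * d) * driftMass d α m)) := by
        simp only [sum_const, card_univ, Fintype.card_fin, nsmul_eq_mul, hcardbox]
        rw [sum_mul, mul_sum]
        exact sum_congr rfl fun k _ => by ring
    _ ≤ (1 - θ)⁻¹ * (d * 2 ^ d * (2 * (1 + C) ^ 2) * (2 ^ (m * d) * driftMass d α m)) := by
        gcongr
        exact geom_sum_le (by positivity) (scaleRatio_lt_one hd) _
    _ = _ := by ring

/-- Union bound over m + 2 scales and all pairs of points of the box. -/
theorem measure_not_hasCommonNeighbours_le {w : Sym2 (Lat d) → Ω → ℝ} (hw : IsConductance P w)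
    {C : ℝ} (hC0 : 0 < C) (hC : ∀ e : Edge d, ∀ᵐ ω ∂P, w e ω ≤ C) (m : ℕ) {r : ℝ} (hr : 4 ≤ r) :
    P.real {ω | ¬ HasCommonNeighbours (fun e => w e ω) m r} ≤
      (m + 2) * (2 ^ ((m + 1) * d)) ^ 2 * Real.exp (-r / (4 * C ^ 4)) := by
  classical
  let bad : ℕ → Lat d → Lat d → Set Ω := fun k x y =>
    if r ≤ 2 ^ (k * d) ∧ y ∈ dyadicCube m k x ∧ x ≠ y then
      {ω | ∑ z ∈ dyadicCube m k x, offDiag (fun e => w e ω) x z * offDiag (fun e => w e ω) z y <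
        (2 : ℝ) ^ (k * d) / 4} else ∅
  have hsub : {ω | ¬ HasCommonNeighbours (fun e => w e ω) m r} ⊆
      ⋃ p ∈ range (m + 2) ×ˢ (box d (2 ^ m) ×ˢ box d (2 ^ m)), bad p.1 p.2.1 p.2.2 := by
    intro ω hω
    simp only [HasCommonNeighbours, Set.mem_ofPred_eq, not_forall, not_le] at hω
    obtain ⟨k, hk, hrk, x, hx, y, hy, hxy, hlt⟩ := hω
    refine Set.mem_iUnion₂.2 ⟨(k, x, y), ?_, ?_⟩
    · exact mem_product.2 ⟨hk, mem_product.2 ⟨hx, (mem_filter.1 hy).1⟩⟩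
    · simp only [bad]
      rw [if_pos ⟨hrk, hy, hxy⟩]
      exact hlt
  have hbad : ∀ p ∈ range (m + 2) ×ˢ (box d (2 ^ m) ×ˢ box d (2 ^ m)),
      P.real (bad p.1 p.2.1 p.2.2) ≤ Real.exp (-r / (4 * C ^ 4)) := by
    rintro ⟨k, x, y⟩ hp
    simp only [mem_product] at hp
    simp only [bad]
    split_ifs with h
    · obtain ⟨hrk, hy, hxy⟩ := h
      have hcard : ((dyadicCube m k x).card : ℝ) = 2 ^ (k * d) := by
        rw [card_dyadicCube (Nat.lt_succ_iff.1 (mem_range.1 hp.1)) hp.2.1]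
        norm_cast
      have h4 : 4 ≤ (dyadicCube m k x).card := by
        have : (4 : ℝ) ≤ (dyadicCube m k x).card := by rw [hcard]; linarith
        exact_mod_cast this
      have := measure_common_neighbours_lt_le hw hC0 hC (dyadicCube m k x) (x := x) (y := y)
        (mem_filter.2 ⟨hp.2.1, rfl⟩) hy hxy h4
      rw [hcard] at this
      refine this.trans (Real.exp_le_exp.2 ?_)
      gcongr
    · simp only [measureReal_empty]
      positivity
  calc P.real {ω | ¬ HasCommonNeighbours (fun e => w e ω) m r}
      ≤ P.real (⋃ p ∈ range (m + 2) ×ˢ (box d (2 ^ m) ×ˢ box d (2 ^ m)), bad p.1 p.2.1 p.2.2) :=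
        measureReal_mono hsub (measure_ne_top P _)
    _ ≤ ∑ p ∈ range (m + 2) ×ˢ (box d (2 ^ m) ×ˢ box d (2 ^ m)), P.real (bad p.1 p.2.1 p.2.2) :=
        measureReal_biUnion_finset_le _ _
    _ ≤ ∑ _p ∈ range (m + 2) ×ˢ (box d (2 ^ m) ×ˢ box d (2 ^ m)),
          Real.exp (-r / (4 * C ^ 4)) := sum_le_sum hbad
    _ = _ := by
        rw [sum_const, nsmul_eq_mul, card_product, card_product, card_box, card_range]
        push_cast
        ring

end Events

/-! ### Poincaré inequality, solvability and energy of the corrector -/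

section Corrector

variable {d : ℕ} {α : ℝ} {c : Sym2 (Lat d) → ℝ}

theorem kernel_comm (x y : Lat d) : kernel α c x y = kernel α c y x := by
  rw [kernel, kernel, Sym2.eq_swap, ← len_neg (x - y), neg_sub]

theorem kernel_nonneg (hα : 0 < α) (h0 : ∀ e : Edge d, 0 ≤ c e) (x y : Lat d) :
    0 ≤ kernel α c x y := by
  rcases eq_or_ne x y with rfl | h
  -- On the diagonal the denominator is 0, and division by zero returns 0; the arbitrary value of c
  -- there is harmless.
  · have hd0 : (d : ℝ) + α ≠ 0 := by positivity
    have hlen : len (x - x) = 0 := by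
      rw [len, norm_eq_zero]
      ext i
      simp [toE_apply]
    rw [kernel, hlen, Real.zero_rpow hd0, div_zero]
  · exact div_nonneg (h0 ⟨s(x, y), by simpa using h⟩) (Real.rpow_nonneg (len_nonneg _) _)

theorem genOn_apply (U : Finset (Lat d)) (f : U → EuclideanSpace ℝ (Fin d)) (x : U) (i : Fin d) :
    genOn α c U f x i =
      generator (fun x y : U => kernel α c x y) (fun y => f y i) x := by
  rw [genOn, generator_apply, WithLp.ofLp_sum, Finset.sum_apply, ← sum_erase univ (a := x)]
  · rfl
  · simp

theorem energyOn_eq (U : Finset (Lat d)) (f : U → EuclideanSpace ℝ (Fin d)) :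
    energyOn α c U f =
      ∑ i : Fin d, dirichlet (fun x y : U => kernel α c x y) (fun x => f x i) := by
  simp only [energyOn, dirichlet, mul_sum]
  refine sum_congr rfl fun i _ => sum_congr rfl fun x _ => ?_
  rw [← sum_erase univ (a := x)]
  · exact sum_congr rfl fun y _ => by ring
  · simp

theorem isCorrector_iff (m : ℕ) (φ : box d (2 ^ m) → EuclideanSpace ℝ (Fin d)) :
    IsCorrector α c m φ ↔ ∀ i, generator (fun x y : box d (2 ^ m) => kernel α c x y)
        (fun x => φ x i) = (fun x : box d (2 ^ m) => -drift α c m x i + avg (box d (2 ^ m))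
          (fun y => drift α c m y) i) ∧ ∑ x, φ x i = 0 := by
  have h1 : (∑ x, φ x = 0) ↔ ∀ i, ∑ x, φ x i = 0 := by
    constructor
    · intro h i
      have := congrArg (fun v : EuclideanSpace ℝ (Fin d) => v i) h
      simpa [WithLp.ofLp_sum, Finset.sum_apply] using this
    · intro h
      ext i
      simpa [WithLp.ofLp_sum, Finset.sum_apply] using h i
  rw [IsCorrector, h1]
  constructor
  · rintro ⟨h2, h3⟩ i
    refine ⟨funext fun x => ?_, h3 i⟩
    rw [← genOn_apply, h2 x]
    rfl
  · intro h
    refine ⟨fun x => ?_, fun i => (h i).2⟩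
    ext i
    rw [genOn_apply, (h i).1]
    rfl

/-- The compatibility condition for solvability, as the generator only produces functions of sum
zero. -/
theorem sum_neg_drift_add_avg (m : ℕ) (i : Fin d) :
    ∑ x : box d (2 ^ m), (-drift α c m x i +
      avg (box d (2 ^ m)) (fun y => drift α c m y) i) = 0 := by
  have hN : ((box d (2 ^ m)).card : ℝ) ≠ 0 := by
    rw [card_box]; positivity
  rw [sum_add_distrib, sum_const, sum_neg_distrib, nsmul_eq_mul, card_univ, Fintype.card_coe, avg,
    PiLp.smul_apply, smul_eq_mul, mul_inv_cancel_left₀ hN, WithLp.ofLp_sum, Finset.sum_apply]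
  exact neg_add_cancel _

/-- The constant in the Poincaré inequality. -/
def poincareConst (d : ℕ) (α C : ℝ) : ℝ := 32 * C * Real.sqrt d ^ ((d : ℝ) + α)

/-- Poincaré inequality on dyadic cubes with many common neighbours. -/
theorem poincare_of_hasCommonNeighbours (hα : 0 < α) {C : ℝ} (hC0 : 0 < C)
    (h0 : ∀ e : Edge d, 0 ≤ c e) (hC : ∀ e : Edge d, c e ≤ C) {m : ℕ} {r : ℝ}
    (hcn : HasCommonNeighbours c m r) {k : ℕ} (hk : k ≤ m + 1) (hr : r ≤ 2 ^ (k * d))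
    (f : box d (2 ^ m) → ℝ) :
    ∑ x, (f x - cellAvg (boxIndex m k) f x) ^ 2 ≤
      poincareConst d α C * ((2 : ℝ) ^ α) ^ k *
        dirichlet (fun x y : box d (2 ^ m) => kernel α c x y) f := by
  set N : ℝ := 2 ^ (k * d) with hN
  have hN0 : 0 < N := by positivity
  have hcard : ∀ x : box d (2 ^ m), ((cellOf (boxIndex m k) x).card : ℝ) = N := by
    intro x
    rw [card_cellOf hk, hN]
    norm_cast
  have hoff0 : ∀ x y, 0 ≤ offDiag c x y := by
    intro x y
    unfold offDiag
    split_ifs with h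
    · exact le_rfl
    · exact h0 ⟨s(x, y), by simpa using h⟩
  have hoffC : ∀ x y, offDiag c x y ≤ C := by
    intro x y
    unfold offDiag
    split_ifs with h
    · exact hC0.le
    · exact hC ⟨s(x, y), by simpa using h⟩
  have hoffsymm : ∀ x y, offDiag c x y = offDiag c y x := by
    intro x y
    unfold offDiag
    rw [Sym2.eq_swap]
    simp only [eq_comm]
  have hd0 : (0 : ℝ) < d + α := by positivity
  have hker := fun x y => kernel_nonneg hα h0 x y
  -- D bounds |x − y|^{d+α} inside a cube of side 2^k; dividing by its 2^{kd} points leaves the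
  -- growth 2^{αk}.
  set D : ℝ := (Real.sqrt d * 2 ^ k) ^ ((d : ℝ) + α) with hD
  have hD0 : 0 ≤ D := by positivity
  have hcmp : ∀ x y : box d (2 ^ m), boxIndex m k y = boxIndex m k x →
      offDiag c x y * (f x - f y) ^ 2 ≤ D * (kernel α c x y * (f x - f y) ^ 2) := by
    intro x y hxy
    rw [← mul_assoc]
    refine mul_le_mul_of_nonneg_right ?_ (sq_nonneg _)
    unfold offDiag
    split_ifs with h
    · exact mul_nonneg hD0 (hker _ _)
    · have hlen : 0 < len (x.1 - y.1) :=
        zero_lt_one.trans_le (one_le_len (sub_ne_zero.2 h))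
      have hle : len (x.1 - y.1) ^ ((d : ℝ) + α) ≤ D :=
        Real.rpow_le_rpow hlen.le (len_sub_le_of_dyadicIndex_eq hxy.symm) hd0.le
      have hpos : 0 < len (x.1 - y.1) ^ ((d : ℝ) + α) := Real.rpow_pos_of_pos hlen _
      calc c s(x.1, y.1) = len (x.1 - y.1) ^ ((d : ℝ) + α) * kernel α c x y := by
            rw [kernel]; field_simp
        _ ≤ D * kernel α c x y := mul_le_mul_of_nonneg_right hle (hker _ _)
  have hmain := sum_cellOf_sq_le_of_common_neighbours (boxIndex m k)
    (fun x y : box d (2 ^ m) => offDiag c x y) hC0.le hN0 hcard (fun x y => hoff0 x y)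
    (fun x y => hoffC x y) (fun x y => hoffsymm x y)
    (by
      intro x y hxy hyx
      rw [sum_cellOf x (fun z => offDiag c x z * offDiag c z y)]
      exact hcn k (mem_range.2 (by lia)) hr x x.2 y (mem_filter.2 ⟨y.2, hyx⟩)
        fun h => hxy (Subtype.ext h)) f
  have hDN : N⁻¹ * D = Real.sqrt d ^ ((d : ℝ) + α) * ((2 : ℝ) ^ α) ^ k := by
    have h2 : ((2 : ℝ) ^ k) ^ ((d : ℝ) + α) = N * ((2 : ℝ) ^ α) ^ k := by
      rw [hN, ← Real.rpow_natCast, ← Real.rpow_natCast, ← Real.rpow_natCast,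
        ← Real.rpow_mul (by norm_num), ← Real.rpow_mul (by norm_num),
        ← Real.rpow_add (by norm_num)]
      congr 1
      push_cast
      ring
    rw [hD, Real.mul_rpow (Real.sqrt_nonneg _) (by positivity), h2]
    field_simp
  calc ∑ x, (f x - cellAvg (boxIndex m k) f x) ^ 2
      ≤ ∑ x, ((cellOf (boxIndex m k) x).card : ℝ)⁻¹ *
          ∑ y ∈ cellOf (boxIndex m k) x, (f x - f y) ^ 2 := sum_sub_cellAvg_sq_le _ f
    _ = N⁻¹ * ∑ x, ∑ y ∈ cellOf (boxIndex m k) x, (f x - f y) ^ 2 := by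
        simp only [hcard, ← mul_sum]
    _ ≤ N⁻¹ * (16 * C * ∑ x, ∑ y ∈ cellOf (boxIndex m k) x,
          offDiag c x y * (f x - f y) ^ 2) := by gcongr
    _ ≤ N⁻¹ * (16 * C * ∑ x, ∑ y ∈ cellOf (boxIndex m k) x,
          D * (kernel α c x y * (f x - f y) ^ 2)) := by
        refine mul_le_mul_of_nonneg_left (mul_le_mul_of_nonneg_left ?_ (by positivity))
          (by positivity)
        exact sum_le_sum fun x _ => sum_le_sum fun y hy => hcmp x y (mem_cellOf.1 hy)
    _ ≤ N⁻¹ * (16 * C * ∑ x : box d (2 ^ m), ∑ y : box d (2 ^ m),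
          D * (kernel α c x y * (f x - f y) ^ 2)) := by
        refine mul_le_mul_of_nonneg_left (mul_le_mul_of_nonneg_left ?_ (by positivity))
          (by positivity)
        refine sum_le_sum fun x _ =>
          sum_le_sum_of_subset_of_nonneg (subset_univ _) fun y _ _ => ?_
        exact mul_nonneg hD0 (mul_nonneg (hker _ _) (sq_nonneg _))
    _ = 32 * C * (N⁻¹ * D) * dirichlet (fun x y : box d (2 ^ m) => kernel α c x y) f := by
        simp only [dirichlet, ← mul_sum]
        ring
    _ = _ := by
        rw [hDN, poincareConst]
        ring

theorem cellAvg_top (m : ℕ) {f : box d (2 ^ m) → ℝ} (hf : ∑ x, f x = 0) (x : box d (2 ^ m)) :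
    cellAvg (boxIndex m (m + 1)) f x = 0 := by
  rw [cellAvg, cellOf_top, hf, mul_zero]

theorem dirichlet_nonneg {X : Type*} [Fintype X] {K : X → X → ℝ} (hK : ∀ x y, 0 ≤ K x y)
    (f : X → ℝ) : 0 ≤ dirichlet K f :=
  mul_nonneg (by norm_num) (sum_nonneg fun _ _ => sum_nonneg fun _ _ =>
    mul_nonneg (hK _ _) (sq_nonneg _))

/-- The cube of scale m + 1 is the whole box, so the Poincaré inequality there shows that zero
energy and zero mean force f = 0. -/
theorem existsUnique_isCorrector (hα : 0 < α) {C : ℝ} (hC0 : 0 < C)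
    (h0 : ∀ e : Edge d, 0 ≤ c e) (hC : ∀ e : Edge d, c e ≤ C) {m : ℕ} {r : ℝ}
    (hcn : HasCommonNeighbours c m r) (hr : r ≤ 2 ^ ((m + 1) * d)) :
    ∃! φ : box d (2 ^ m) → EuclideanSpace ℝ (Fin d), IsCorrector α c m φ := by
  have : Nonempty (box d (2 ^ m)) := by
    rw [← Fintype.card_pos_iff, Fintype.card_coe, card_box]
    positivity
  have hsolve : ∀ i : Fin d, ∃! f : box d (2 ^ m) → ℝ,
      generator (fun x y : box d (2 ^ m) => kernel α c x y) f =
        (fun x : box d (2 ^ m) => -drift α c m x i +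
          avg (box d (2 ^ m)) (fun y => drift α c m y) i) ∧
      ∑ x, f x = 0 := by
    intro i
    refine existsUnique_generator_eq (fun x y => kernel_comm _ _) ?_ (sum_neg_drift_add_avg m i)
    intro f hf hs
    have hP := poincare_of_hasCommonNeighbours hα hC0 h0 hC hcn le_rfl hr f
    simp only [hf, mul_zero, cellAvg_top m hs, sub_zero] at hP
    have hz := (sum_eq_zero_iff_of_nonneg fun x _ => sq_nonneg (f x)).1
      (le_antisymm hP (sum_nonneg fun x _ => sq_nonneg (f x)))
    ext x
    exact pow_eq_zero_iff (two_ne_zero) |>.1 (hz x (mem_univ x))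
  choose f hf hf' using hsolve
  simp only [isCorrector_iff]
  refine ⟨fun x => WithLp.toLp 2 fun i => f i x, fun i => hf i, ?_⟩
  intro φ hφ
  ext x i
  exact congrFun (hf' i (fun x => φ x i) (hφ i)) x

/-- The energy of the corrector is controlled by the drift and by its fluctuations at the scales
above the one at which the Poincaré inequality starts to hold. -/
theorem energyOn_le_of_hasCommonNeighbours (hα : 0 < α) (hd : α < d) {C : ℝ} (hC0 : 0 < C)
    (h0 : ∀ e : Edge d, 0 ≤ c e) (hC : ∀ e : Edge d, c e ≤ C) {m : ℕ} {r : ℝ}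
    (hcn : HasCommonNeighbours c m r) {k₀ : ℕ} (hk₀ : k₀ ≤ m + 1) (hr : r ≤ 2 ^ (k₀ * d))
    {φ : box d (2 ^ m) → EuclideanSpace ℝ (Fin d)} (hφ : IsCorrector α c m φ) :
    energyOn α c (box d (2 ^ m)) φ ≤
      poincareConst d α C * (1 + 2 ^ α * (1 - (2 : ℝ) ^ ((α - d) / 2))⁻¹) *
        (d * 2 ^ d * C ^ 2 * (((2 : ℝ) ^ α) ^ k₀ * driftMass d α m ^ 2 * 2 ^ (m * d)) +
          driftFluctuation α c m) := by
  have hd0 : (0 : ℝ) < d := hα.trans hd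
  set θ : ℝ := (2 : ℝ) ^ ((α - d) / 2) with hθ
  have hθ0 : 0 < θ := by positivity
  have hθ1 : θ < 1 := scaleRatio_lt_one hd
  set G : ℝ := (1 - θ)⁻¹ with hG
  have hG0 : 0 < G := inv_pos.2 (by linarith)
  set κ : ℝ := poincareConst d α C with hκ
  have hκ0 : 0 < κ := by
    rw [hκ, poincareConst]
    have : 0 < Real.sqrt d := Real.sqrt_pos.2 hd0
    positivity
  set ρ : ℝ := (2 : ℝ) ^ (((d : ℝ) + α) / 2) with hρ
  have hρ0 : 0 < ρ := by positivity
  have hρθ : (2 : ℝ) ^ α = θ * ρ := by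
    rw [hρ, hθ, ← Real.rpow_add (by norm_num)]
    congr 1
    ring
  have h2α : (0 : ℝ) < 2 ^ α := by positivity
  -- Chosen so that κ/τ + (κ2^α/τ)G = 1, the budget allowed for Young's inequality over all scales.
  set τ : ℝ := κ * (1 + 2 ^ α * G) with hτ
  have hτ0 : 0 < τ := by positivity
  have hker := fun x y => kernel_nonneg hα h0 x y
  have hcoord : ∀ i : Fin d, dirichlet (fun x y : box d (2 ^ m) => kernel α c x y)
      (fun x => φ x i) ≤ τ * (2 ^ d * C ^ 2 * (((2 : ℝ) ^ α) ^ k₀ * driftMass d α m ^ 2 *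
        2 ^ (m * d)) + ∑ k ∈ range (m + 1), ρ ^ k *
          ∑ x : box d (2 ^ m), cellAvg (boxIndex m k) (fun y => drift α c m y i) x ^ 2) := by
    intro i
    obtain ⟨hgen, hsum⟩ := (isCorrector_iff m φ).1 hφ i
    have hE : dirichlet (fun x y : box d (2 ^ m) => kernel α c x y) (fun x => φ x i) =
        ∑ x : box d (2 ^ m), drift α c m x i * φ x i := by
      have h1 := sum_generator_mul (K := fun x y : box d (2 ^ m) => kernel α c x y)
        (fun x y => kernel_comm _ _) (fun x => φ x i)
      rw [hgen] at h1
      simp only [add_mul, sum_add_distrib, ← mul_sum, hsum, mul_zero, add_zero, neg_mul,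
        sum_neg_distrib] at h1
      linarith
    have hmain := dirichlet_le_of_poincare (boxIndex m)
      (fun k x y h => dyadicIndex_succ h) hk₀ (cellAvg_top m hsum)
      (dirichlet_nonneg (fun x y => hker _ _) _) hE
      (p := fun k => κ * ((2 : ℝ) ^ α) ^ k) (t := fun k => τ * ρ ^ k)
      (fun k => by positivity) (t₀ := τ * ((2 : ℝ) ^ α) ^ k₀) (by positivity)
      (fun k hk => poincare_of_hasCommonNeighbours hα hC0 h0 hC hcn (mem_Icc.1 hk).2
        (hr.trans (pow_le_pow_right₀ (by norm_num)
          (Nat.mul_le_mul_right d (mem_Icc.1 hk).1))) _)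
      (by
        have e1 : ∀ k, κ * ((2 : ℝ) ^ α) ^ (k + 1) / (τ * ρ ^ k) =
            κ * 2 ^ α / τ * θ ^ k := by
          intro k
          have : ((2 : ℝ) ^ α) ^ (k + 1) = 2 ^ α * (θ ^ k * ρ ^ k) := by
            rw [pow_succ, ← mul_pow, ← hρθ]
            ring
          rw [this]
          field_simp
        have e2 : κ * ((2 : ℝ) ^ α) ^ k₀ / (τ * ((2 : ℝ) ^ α) ^ k₀) = κ / τ := by
          field_simp
        rw [e2]
        simp only [e1, ← mul_sum]
        calc κ / τ + κ * 2 ^ α / τ * ∑ k ∈ Ico k₀ (m + 1), θ ^ k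
            ≤ κ / τ + κ * 2 ^ α / τ * G := by
              gcongr
              exact geom_sum_le hθ0.le hθ1 _
          _ = κ * (1 + 2 ^ α * G) / τ := by ring
          _ = 1 := div_self hτ0.ne'
          _ ≤ 1 := le_rfl)
    refine hmain.trans ?_
    -- Without averaging no cancellation is used: the drift is bounded pointwise, at the price of
    -- `driftMass` squared.
    have hV : ∑ x : box d (2 ^ m), drift α c m x i ^ 2 ≤
        2 ^ d * 2 ^ (m * d) * (C * driftMass d α m) ^ 2 := by
      calc ∑ x : box d (2 ^ m), drift α c m x i ^ 2
          ≤ ∑ _x : box d (2 ^ m), (C * driftMass d α m) ^ 2 := by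
            refine sum_le_sum fun x _ => ?_
            rw [← sq_abs]
            have := abs_drift_le (α := α) h0 hC m x i
            gcongr
        _ = _ := by
            rw [sum_const, nsmul_eq_mul, card_univ, Fintype.card_coe, card_box]
            push_cast
            ring
    have hF : ∑ k ∈ Ico k₀ (m + 1), τ * ρ ^ k *
          ∑ x : box d (2 ^ m), cellAvg (boxIndex m k) (fun y => drift α c m y i) x ^ 2 ≤
        τ * ∑ k ∈ range (m + 1), ρ ^ k *
          ∑ x : box d (2 ^ m), cellAvg (boxIndex m k) (fun y => drift α c m y i) x ^ 2 := by
      rw [mul_sum]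
      simp only [mul_assoc]
      refine sum_le_sum_of_subset_of_nonneg (fun k hk => mem_range.2 (mem_Ico.1 hk).2)
        fun k _ _ => ?_
      have : 0 ≤ ∑ x : box d (2 ^ m),
        cellAvg (boxIndex m k) (fun y => drift α c m y i) x ^ 2 := sum_nonneg fun _ _ => sq_nonneg _
      positivity
    calc _ ≤ τ * ((2 : ℝ) ^ α) ^ k₀ * (2 ^ d * 2 ^ (m * d) * (C * driftMass d α m) ^ 2) +
          τ * ∑ k ∈ range (m + 1), ρ ^ k *
          ∑ x : box d (2 ^ m), cellAvg (boxIndex m k) (fun y => drift α c m y i) x ^ 2 :=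
          add_le_add (mul_le_mul_of_nonneg_left hV (by positivity)) hF
      _ = _ := by ring
  rw [energyOn_eq]
  refine (sum_le_sum fun i _ => hcoord i).trans (le_of_eq ?_)
  rw [← mul_sum, sum_add_distrib, sum_const, card_univ, Fintype.card_fin, nsmul_eq_mul,
    driftFluctuation]
  ring

end Corrector

/-! ### Comparison with the claimed rate -/

section Rates

variable {d : ℕ} {α : ℝ}

theorem driftMass_le_of_eq_one (hd : 1 ≤ d) :
    ∃ A : ℝ, 0 < A ∧ ∀ m : ℕ, 1 ≤ m → driftMass d 1 m + 1 ≤ A * m := by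
  refine ⟨8 ^ d * 2 + 1, by positivity, fun m hm => ?_⟩
  have hm' : (1 : ℝ) ≤ m := by exact_mod_cast hm
  have h := driftMass_le_sum (α := 1) one_pos hd m
  simp only [sub_self, Real.rpow_zero, one_pow, sum_const, card_range, nsmul_eq_mul, mul_one,
    Nat.cast_add, Nat.cast_one] at h
  have h8 : (0 : ℝ) < 8 ^ d := by positivity
  nlinarith

theorem driftMass_le_of_lt_one (hα : 0 < α) (hα1 : α < 1) (hd : 1 ≤ d) :
    ∃ A : ℝ, 0 < A ∧ ∀ m : ℕ, driftMass d α m + 1 ≤ A * ((2 : ℝ) ^ (1 - α)) ^ m := by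
  set q : ℝ := (2 : ℝ) ^ (1 - α) with hq
  have hq1 : 1 < q := Real.one_lt_rpow (by norm_num) (by linarith)
  have hq0 : 0 < q - 1 := by linarith
  refine ⟨8 ^ d * (q / (q - 1)) + 1, by positivity, fun m => ?_⟩
  have h := driftMass_le_sum hα hd m
  rw [← hq, geom_sum_eq hq1.ne'] at h
  have h1 : (q ^ (m + 1) - 1) / (q - 1) ≤ q / (q - 1) * q ^ m := by
    rw [div_mul_eq_mul_div]
    refine div_le_div_of_nonneg_right ?_ hq0.le
    rw [pow_succ]
    linarith
  have h2 : 1 ≤ q ^ m := one_le_pow₀ hq1.le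
  calc driftMass d α m + 1 ≤ 8 ^ d * (q / (q - 1) * q ^ m) + q ^ m := by
        refine add_le_add (h.trans ?_) h2
        gcongr
    _ = _ := by ring

theorem exists_sq_le_mul_pow {q : ℝ} (hq : 1 < q) :
    ∃ A : ℝ, 0 < A ∧ ∀ m : ℕ, (m : ℝ) ^ 2 ≤ A * q ^ m := by
  obtain ⟨A, hA⟩ := (tendsto_pow_const_div_const_pow_of_one_lt 2 hq).bddAbove_range
  refine ⟨max A 1, by positivity, fun m => ?_⟩
  have h1 := hA ⟨m, rfl⟩
  have hqm : 0 < q ^ m := by positivity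
  simp only at h1
  rw [div_le_iff₀ hqm] at h1
  exact h1.trans (mul_le_mul_of_nonneg_right (le_max_left _ _) hqm.le)

/-- The energy rate dominates the contributions of the small and of the large scales. -/
theorem exists_le_mul_energyRate (hα : 0 < α) (hα1 : α ≤ 1) (hd : α < d) {γ : ℝ} (hγ : 0 < γ) :
    ∃ A : ℝ, 0 < A ∧ ∀ m : ℕ, 1 ≤ m →
      (m : ℝ) ^ (α / d) * (driftMass d α m + 1) ^ 2 * 2 ^ (m * d) ≤ A * energyRate d α γ m ∧
      (m : ℝ) ^ (1 + 1 / (d : ℝ)) * (2 ^ (m * d) * (driftMass d α m + 1)) ≤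
        A * energyRate d α γ m := by
  have hd0 : (0 : ℝ) < d := hα.trans hd
  have hd1 : 1 ≤ d := Nat.one_le_iff_ne_zero.2 (by rintro rfl; simp at hd0)
  have hpow : ∀ m : ℕ, (2 : ℝ) ^ (m * d) = (2 : ℝ) ^ ((m : ℝ) * d) := fun m => by
    rw [← Real.rpow_natCast]; push_cast; rfl
  have hmin : 0 < min (2 * ((d : ℝ) - α)) d := lt_min (by linarith) hd0
  -- The argument yields the exponent α/d, which is below the claimed one because the minimum is at
  -- most d.
  have hexp : α / d ≤ (1 + γ) * α / min (2 * ((d : ℝ) - α)) d := by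
    rw [div_le_div_iff₀ hd0 hmin]
    have h1 : min (2 * ((d : ℝ) - α)) d ≤ d := min_le_right _ _
    have h2 := mul_pos hγ (mul_pos hα hd0)
    nlinarith [mul_le_mul_of_nonneg_left h1 hα.le]
  rcases hα1.eq_or_lt with rfl | hlt
  · obtain ⟨A, hA, hm⟩ := driftMass_le_of_eq_one hd1
    refine ⟨A ^ 2 + A, by positivity, fun m h1 => ?_⟩
    have hm1 : (1 : ℝ) ≤ m := by exact_mod_cast h1
    have hm0 : (0 : ℝ) < m := by linarith
    have hS := driftMass_nonneg (d := d) 1 m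
    have hrate : (m : ℝ) ^ (2 + 1 / (d : ℝ)) * 2 ^ (m * d) ≤ energyRate d 1 γ m := by
      rw [energyRate, if_pos rfl, hpow]
      refine mul_le_mul_of_nonneg_right (Real.rpow_le_rpow_of_exponent_le hm1 ?_) (by positivity)
      rw [mul_one] at hexp
      linarith
    have hR0 : 0 ≤ energyRate d 1 γ m := le_trans (by positivity) hrate
    constructor
    · calc (m : ℝ) ^ (1 / (d : ℝ)) * (driftMass d 1 m + 1) ^ 2 * 2 ^ (m * d)
          ≤ (m : ℝ) ^ (1 / (d : ℝ)) * (A * m) ^ 2 * 2 ^ (m * d) := by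
            gcongr
            exact hm m h1
        _ = A ^ 2 * ((m : ℝ) ^ (2 + 1 / (d : ℝ)) * 2 ^ (m * d)) := by
            rw [Real.rpow_add hm0, Real.rpow_two]
            ring
        _ ≤ A ^ 2 * energyRate d 1 γ m := by gcongr
        _ ≤ (A ^ 2 + A) * energyRate d 1 γ m := by
            refine mul_le_mul_of_nonneg_right (by linarith) hR0
    · calc (m : ℝ) ^ (1 + 1 / (d : ℝ)) * (2 ^ (m * d) * (driftMass d 1 m + 1))
          ≤ (m : ℝ) ^ (1 + 1 / (d : ℝ)) * (2 ^ (m * d) * (A * m)) := by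
            gcongr
            exact hm m h1
        _ = A * ((m : ℝ) ^ (2 + 1 / (d : ℝ)) * 2 ^ (m * d)) := by
            rw [Real.rpow_add hm0, Real.rpow_add hm0, Real.rpow_two, Real.rpow_one]
            ring
        _ ≤ A * energyRate d 1 γ m := by gcongr
        _ ≤ (A ^ 2 + A) * energyRate d 1 γ m := by
            refine mul_le_mul_of_nonneg_right ?_ hR0
            nlinarith [sq_nonneg A]
  · obtain ⟨A, hA, hm⟩ := driftMass_le_of_lt_one hα hlt hd1
    set q : ℝ := (2 : ℝ) ^ (1 - α) with hq
    have hq1 : 1 < q := Real.one_lt_rpow (by norm_num) (by linarith)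
    obtain ⟨B, hB, hBm⟩ := exists_sq_le_mul_pow hq1
    refine ⟨A ^ 2 + A * B, by positivity, fun m h1 => ?_⟩
    have hm1 : (1 : ℝ) ≤ m := by exact_mod_cast h1
    have hm0 : (0 : ℝ) < m := by linarith
    have hS := driftMass_nonneg (d := d) α m
    have hrate : (m : ℝ) ^ (α / d) * ((q ^ m) ^ 2 * 2 ^ (m * d)) ≤ energyRate d α γ m := by
      rw [energyRate, if_neg hlt.ne, hpow]
      have : (q ^ m) ^ 2 * (2 : ℝ) ^ ((m : ℝ) * d) = (2 : ℝ) ^ ((m : ℝ) * (d + 2 * (1 - α))) := by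
        rw [hq, ← pow_mul, ← Real.rpow_natCast, ← Real.rpow_mul (by norm_num),
          ← Real.rpow_add (by norm_num)]
        congr 1
        push_cast
        ring
      rw [this]
      exact mul_le_mul_of_nonneg_right (Real.rpow_le_rpow_of_exponent_le hm1 hexp)
        (by positivity)
    have hR0 : 0 ≤ energyRate d α γ m := le_trans (by positivity) hrate
    constructor
    · calc (m : ℝ) ^ (α / d) * (driftMass d α m + 1) ^ 2 * 2 ^ (m * d)
          ≤ (m : ℝ) ^ (α / d) * (A * q ^ m) ^ 2 * 2 ^ (m * d) := by
            gcongr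
            exact hm m
        _ = A ^ 2 * ((m : ℝ) ^ (α / d) * ((q ^ m) ^ 2 * 2 ^ (m * d))) := by ring
        _ ≤ A ^ 2 * energyRate d α γ m := by gcongr
        _ ≤ (A ^ 2 + A * B) * energyRate d α γ m :=
            mul_le_mul_of_nonneg_right (by nlinarith [mul_pos hA hB]) hR0
    -- The fluctuation term carries q^m once while the rate has it squared; the spare factor absorbs
    -- every power of m.
    · have h2 : (m : ℝ) ^ (1 + 1 / (d : ℝ)) ≤ B * q ^ m := by
        refine le_trans ?_ (hBm m)
        rw [← Real.rpow_two]
        refine Real.rpow_le_rpow_of_exponent_le hm1 ?_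
        have : 1 / (d : ℝ) ≤ 1 := by
          rw [div_le_one hd0]
          exact_mod_cast hd1
        linarith
      have h3 : 1 ≤ (m : ℝ) ^ (α / d) := Real.one_le_rpow hm1 (by positivity)
      calc (m : ℝ) ^ (1 + 1 / (d : ℝ)) * (2 ^ (m * d) * (driftMass d α m + 1))
          ≤ (B * q ^ m) * (2 ^ (m * d) * (A * q ^ m)) := by
            gcongr
            exact hm m
        _ = A * B * (1 * ((q ^ m) ^ 2 * 2 ^ (m * d))) := by ring
        _ ≤ A * B * ((m : ℝ) ^ (α / d) * ((q ^ m) ^ 2 * 2 ^ (m * d))) := by gcongr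
        _ ≤ A * B * energyRate d α γ m := by gcongr
        _ ≤ (A ^ 2 + A * B) * energyRate d α γ m :=
            mul_le_mul_of_nonneg_right (by nlinarith [sq_nonneg A]) hR0

/-- The first dyadic scale at which cubes have at least `r` points. -/
theorem exists_scale (hα : 0 < α) (hd : 1 ≤ d) {m : ℕ} {r : ℝ} (hr : 1 < r)
    (hm : r ≤ 2 ^ ((m + 1) * d)) :
    ∃ k ≤ m + 1, r ≤ 2 ^ (k * d) ∧ ((2 : ℝ) ^ α) ^ k ≤ (2 ^ d * r) ^ (α / d) := by
  classical
  have hex : ∃ k : ℕ, r ≤ (2 : ℝ) ^ (k * d) := ⟨m + 1, hm⟩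
  refine ⟨Nat.find hex, Nat.find_min' hex hm, Nat.find_spec hex, ?_⟩
  -- Scale 0 is excluded by 1 < r. By minimality the preceding scale has fewer than r points, hence
  -- 2^{kd} ≤ 2^d r.
  obtain ⟨j, hj⟩ : ∃ j, Nat.find hex = j + 1 := Nat.exists_eq_succ_of_ne_zero fun h => by
    have := Nat.find_spec hex
    rw [h] at this
    simp at this
    linarith
  have hlt : (2 : ℝ) ^ (j * d) < r := not_le.1 (Nat.find_min hex (by lia))
  have hd0 : (d : ℝ) ≠ 0 := by positivity
  rw [hj]
  have h1 : ((2 : ℝ) ^ α) ^ (j + 1) = ((2 : ℝ) ^ ((j + 1) * d)) ^ (α / d) := by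
    rw [← Real.rpow_natCast, ← Real.rpow_natCast, ← Real.rpow_mul (by norm_num),
      ← Real.rpow_mul (by norm_num)]
    congr 1
    push_cast
    field_simp
  rw [h1]
  refine Real.rpow_le_rpow (by positivity) ?_ (by positivity)
  rw [add_mul, one_mul, pow_add, mul_comm]
  gcongr

end Rates

/-! ### A measurable last time -/

section BorelCantelli

variable {Ω : Type*} [MeasurableSpace Ω] {P : Measure Ω} [IsProbabilityMeasure P]

/-- The Borel–Cantelli lemma with a measurable last time of occurrence. -/
theorem exists_measurable_last_time {s : ℕ → Set Ω} {b : ℕ → ℝ} (hb : Summable b)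
    (hs : ∀ᶠ m in Filter.atTop, P.real (s m) ≤ b m) :
    ∃ T : Ω → ℕ, Measurable T ∧ (∀ ω, 1 ≤ T ω) ∧ ∀ᵐ ω ∂P, ∀ m, T ω < m → ω ∉ s m := by
  classical
  have hsum : Summable fun m => P.real (s m) := by
    refine Summable.of_norm_bounded_eventually_nat hb ?_
    filter_upwards [hs] with m hm
    rwa [Real.norm_of_nonneg measureReal_nonneg]
  have hfin : ∑' m, P (toMeasurable P (s m)) ≠ ⊤ := by
    have := hsum.tsum_ofReal_ne_top
    simpa [measure_toMeasurable] using this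
  have hev := ae_eventually_notMem hfin
  -- Measurable hulls stand in for the events, which are not assumed measurable.
  let good : ℕ → Set Ω := fun n => ⋂ m, ⋂ (_ : n < m), (toMeasurable P (s m))ᶜ
  have hgood : ∀ n, MeasurableSet (good n) := fun n =>
    MeasurableSet.iInter fun m => MeasurableSet.iInter fun _ =>
      (measurableSet_toMeasurable P (s m)).compl
  -- The second alternative, which occurs only on a null set, makes the search for n total.
  let p : Ω → ℕ → Prop := fun ω n => ω ∈ good n ∨ ω ∉ ⋃ j, good j
  have hp : ∀ ω, ∃ n, p ω n := by
    intro ω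
    by_cases h : ω ∈ ⋃ j, good j
    · obtain ⟨j, hj⟩ := Set.mem_iUnion.1 h
      exact ⟨j, Or.inl hj⟩
    · exact ⟨0, Or.inr h⟩
  have hpm : ∀ n, MeasurableSet {ω | p ω n} := fun n =>
    (hgood n).union (MeasurableSet.iUnion hgood).compl
  refine ⟨fun ω => Nat.find (hp ω) + 1, (measurable_find hp hpm).add_const 1,
    fun ω => Nat.le_add_left _ _, ?_⟩
  filter_upwards [hev] with ω hω m hm hmem
  obtain ⟨N, hN⟩ := Filter.eventually_atTop.1 hω
  have hin : ω ∈ ⋃ j, good j :=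
    Set.mem_iUnion.2 ⟨N, Set.mem_iInter₂.2 fun m hm => hN m hm.le⟩
  rcases Nat.find_spec (hp ω) with h | h
  · exact Set.mem_iInter₂.1 h m (by lia) (subset_toMeasurable P _ hmem)
  · exact h hin

end BorelCantelli

/-! ### Summable probabilities of the bad events -/

section AlmostSure

variable {d : ℕ} {α : ℝ} {Ω : Type*} [MeasurableSpace Ω] {P : Measure Ω} [IsProbabilityMeasure P]

/-- Markov's inequality. The factor m^{1+1/d} has summable inverse, and for α = 1 it multiplies
`driftMass` ≲ m to exactly the available m^{2+1/d}. -/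
theorem measure_driftFluctuation_ge_le (hα : 0 < α) (hd : α < d) (hd1 : 1 ≤ d)
    {w : Sym2 (Lat d) → Ω → ℝ} (hw : IsConductance P w) {C : ℝ}
    (hC : ∀ e : Edge d, ∀ᵐ ω ∂P, w e ω ≤ C) {m : ℕ} (hm : 1 ≤ m) :
    P.real {ω | (m : ℝ) ^ (1 + 1 / (d : ℝ)) * (2 ^ (m * d) * (driftMass d α m + 1)) ≤
        driftFluctuation α (fun e => w e ω) m} ≤
      d * (1 - (2 : ℝ) ^ ((α - d) / 2))⁻¹ * 2 ^ d * (2 * (1 + C) ^ 2) *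
        ((m : ℝ) ^ (1 + 1 / (d : ℝ)))⁻¹ := by
  obtain ⟨h1, h2⟩ := integral_driftFluctuation_le hα hd hd1 hw hC m
  have hm0 : (0 : ℝ) < m := by exact_mod_cast hm
  have hS := driftMass_nonneg (d := d) α m
  have hmk := mul_meas_ge_le_integral_of_nonneg (Filter.Eventually.of_forall fun ω => ?_) h1
    ((m : ℝ) ^ (1 + 1 / (d : ℝ)) * (2 ^ (m * d) * (driftMass d α m + 1)))
  · set B : ℝ := d * (1 - (2 : ℝ) ^ ((α - d) / 2))⁻¹ * 2 ^ d * (2 * (1 + C) ^ 2) with hB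
    have hB0 : 0 ≤ B := by
      have := sub_pos.2 (scaleRatio_lt_one hd)
      positivity
    set a : ℝ := (m : ℝ) ^ (1 + 1 / (d : ℝ)) with ha
    have ha0 : 0 < a := by positivity
    -- The added 1 keeps the threshold positive, so that D can be cancelled.
    set D : ℝ := 2 ^ (m * d) * (driftMass d α m + 1) with hD
    have hD0 : 0 < D := by positivity
    have h3 : B * (2 ^ (m * d) * driftMass d α m) ≤ B * D := by
      refine mul_le_mul_of_nonneg_left ?_ hB0
      rw [hD]
      gcongr
      linarith
    have h4 := hmk.trans (h2.trans h3)
    rw [← div_eq_mul_inv, le_div_iff₀ ha0]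
    refine le_of_mul_le_mul_right ?_ hD0
    linarith
  · exact sum_nonneg fun i _ => sum_nonneg fun k _ => mul_nonneg (by positivity)
      (sum_nonneg fun x _ => sq_nonneg _)

/-- The threshold makes the exponential at most e^{-(4d+2)m}, which beats the union bound 2e^m·4^d
e^{4dm} by e^{-m}; the extra 4 ensures r ≥ 4. -/
theorem measure_not_hasCommonNeighbours_le_exp {w : Sym2 (Lat d) → Ω → ℝ}
    (hw : IsConductance P w) {C : ℝ} (hC0 : 0 < C) (hC : ∀ e : Edge d, ∀ᵐ ω ∂P, w e ω ≤ C)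
    {m : ℕ} (hm : 1 ≤ m) :
    P.real {ω | ¬ HasCommonNeighbours (fun e => w e ω) m ((4 * C ^ 4 * (4 * d + 2) + 4) * m)} ≤
      2 * 4 ^ d * Real.exp (-(m : ℝ)) := by
  have hm1 : (1 : ℝ) ≤ m := by exact_mod_cast hm
  have hC4 : 0 < C ^ 4 := by positivity
  have hr : 4 ≤ (4 * C ^ 4 * (4 * d + 2) + 4) * (m : ℝ) := by
    have : 0 ≤ 4 * C ^ 4 * (4 * d + 2) := by positivity
    nlinarith
  refine (measure_not_hasCommonNeighbours_le hw hC0 hC m hr).trans ?_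
  have h1 : Real.exp (-((4 * C ^ 4 * (4 * d + 2) + 4) * (m : ℝ)) / (4 * C ^ 4)) ≤
      Real.exp (-((4 * d + 2) * (m : ℝ))) := by
    refine Real.exp_le_exp.2 ?_
    rw [div_le_iff₀ (by positivity)]
    nlinarith
  have h2 : (m : ℝ) + 2 ≤ 2 * Real.exp m := by
    have := Real.add_one_le_exp (m : ℝ)
    linarith
  have h3 : ((2 : ℝ) ^ ((m + 1) * d)) ^ 2 ≤ 4 ^ d * Real.exp (4 * d * m) := by
    have h4 : (2 : ℝ) ≤ Real.exp 1 := by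
      have := Real.add_one_le_exp (1 : ℝ)
      linarith
    have h5 : ((2 : ℝ) ^ ((m + 1) * d)) ^ 2 = 4 ^ d * 2 ^ (2 * d * m) := by
      have : (4 : ℝ) = 2 ^ 2 := by norm_num
      rw [this, ← pow_mul, ← pow_mul, ← pow_add]
      congr 1
      ring
    rw [h5]
    refine mul_le_mul_of_nonneg_left ?_ (by positivity)
    calc (2 : ℝ) ^ (2 * d * m) ≤ Real.exp 1 ^ (2 * d * m) := by gcongr
      _ = Real.exp (2 * d * m) := by
          rw [← Real.exp_nat_mul]
          push_cast
          ring_nf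
      _ ≤ Real.exp (4 * d * m) := by
          refine Real.exp_le_exp.2 ?_
          have : 0 ≤ (d : ℝ) * m := by positivity
          linarith
  calc ((m : ℝ) + 2) * (2 ^ ((m + 1) * d)) ^ 2 *
        Real.exp (-((4 * C ^ 4 * (4 * d + 2) + 4) * (m : ℝ)) / (4 * C ^ 4))
      ≤ (2 * Real.exp m) * (4 ^ d * Real.exp (4 * d * m)) *
        Real.exp (-((4 * d + 2) * (m : ℝ))) := by gcongr
    _ = 2 * 4 ^ d * (Real.exp m * Real.exp (4 * d * m) *
        Real.exp (-((4 * d + 2) * (m : ℝ)))) := by ring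
    _ = 2 * 4 ^ d * Real.exp (-(m : ℝ)) := by
        rw [← Real.exp_add, ← Real.exp_add]
        congr 2
        ring

theorem eventually_mul_le_two_pow (hd : 1 ≤ d) (Λ : ℝ) :
    ∀ᶠ m : ℕ in Filter.atTop, Λ * m ≤ (2 : ℝ) ^ ((m + 1) * d) := by
  have h := (tendsto_pow_const_div_const_pow_of_one_lt 1 (r := (2 : ℝ)) (by norm_num)).const_mul Λ
  rw [mul_zero] at h
  filter_upwards [h.eventually_le_const one_pos] with m hm
  have h2 : (0 : ℝ) < 2 ^ m := by positivity
  rw [pow_one, ← mul_div_assoc, div_le_one h2] at hm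
  refine hm.trans (pow_le_pow_right₀ (by norm_num) ?_)
  nlinarith

end AlmostSure

end StableConductance

end

/-! ### The main theorem -/

open StableConductance in
theorem proposition3p2 {d : ℕ} {α : ℝ} (hα : 0 < α) (hα1 : α ≤ 1) (hd : α < d)
    {Ω : Type*} [MeasurableSpace Ω] (P : Measure Ω) [IsProbabilityMeasure P]
    (w : Sym2 (Lat d) → Ω → ℝ) (hw : IsConductance P w) (γ : ℝ) (hγ : 0 < γ) :
    ∃ C : ℝ, 0 < C ∧ ∃ mstar : Ω → ℕ, Measurable mstar ∧ (∀ ω, 1 ≤ mstar ω) ∧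
      ∀ᵐ ω ∂P, ∀ m : ℕ, mstar ω < m →
        (∃! φ : box d (2 ^ m) → EuclideanSpace ℝ (Fin d), IsCorrector α (fun e => w e ω) m φ) ∧
        ∀ φ : box d (2 ^ m) → EuclideanSpace ℝ (Fin d), IsCorrector α (fun e => w e ω) m φ →
          energyOn α (fun e => w e ω) (box d (2 ^ m)) φ ≤ C * energyRate d α γ m := by
  obtain ⟨C, hC0, hC⟩ := hw.bounded
  have hd0 : (0 : ℝ) < d := hα.trans hd
  have hd1 : 1 ≤ d := Nat.one_le_iff_ne_zero.2 (by rintro rfl; simp at hd0)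
  obtain ⟨A, hA, hrate⟩ := exists_le_mul_energyRate hα hα1 hd hγ
  set Λ : ℝ := 4 * C ^ 4 * (4 * d + 2) + 4 with hΛ
  have hΛ4 : 4 ≤ Λ := by
    have : 0 ≤ 4 * C ^ 4 * (4 * (d : ℝ) + 2) := by positivity
    linarith
  set τ : ℝ := poincareConst d α C * (1 + 2 ^ α * (1 - (2 : ℝ) ^ ((α - d) / 2))⁻¹) with hτ
  have hτ0 : 0 < τ := by
    have h1 := sub_pos.2 (scaleRatio_lt_one hd)
    have h2 : 0 < Real.sqrt d := Real.sqrt_pos.2 hd0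
    rw [hτ, poincareConst]
    positivity
  set F : ℝ := d * 2 ^ d * C ^ 2 * (2 ^ d * Λ) ^ (α / d) with hF
  have hF0 : 0 < F := by positivity
  refine ⟨τ * (F * A + A), by positivity, ?_⟩
  set B : ℝ := d * (1 - (2 : ℝ) ^ ((α - d) / 2))⁻¹ * 2 ^ d * (2 * (1 + C) ^ 2) with hB
  -- The first set is deterministic, empty for large m; including it makes the last time also exceed
  -- every m whose box is too small for the scale Λm.
  set s : ℕ → Set Ω := fun m => {ω | ¬ (Λ * m ≤ 2 ^ ((m + 1) * d))} ∪
    ({ω | ¬ HasCommonNeighbours (fun e => w e ω) m (Λ * m)} ∪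
      {ω | (m : ℝ) ^ (1 + 1 / (d : ℝ)) * (2 ^ (m * d) * (driftMass d α m + 1)) ≤
        driftFluctuation α (fun e => w e ω) m}) with hs
  have hsum : Summable fun m : ℕ => 2 * 4 ^ d * Real.exp (-(m : ℝ)) +
      B * ((m : ℝ) ^ (1 + 1 / (d : ℝ)))⁻¹ := by
    refine (Real.summable_exp_neg_nat.mul_left _).add (Summable.mul_left _ ?_)
    refine Real.summable_nat_rpow_inv.2 ?_
    have : 0 < 1 / (d : ℝ) := by positivity
    linarith
  obtain ⟨T, hTm, hT1, hT⟩ := exists_measurable_last_time (P := P) (s := s) hsum (by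
    filter_upwards [eventually_mul_le_two_pow hd1 Λ, Filter.eventually_ge_atTop 1] with m h1 h2
    have he : s m = {ω | ¬ HasCommonNeighbours (fun e => w e ω) m (Λ * m)} ∪
      {ω | (m : ℝ) ^ (1 + 1 / (d : ℝ)) * (2 ^ (m * d) * (driftMass d α m + 1)) ≤
        driftFluctuation α (fun e => w e ω) m} := by
      refine Set.union_eq_self_of_subset_left fun ω h => ?_
      exact absurd h1 h
    rw [he]
    exact (measureReal_union_le _ _).trans (add_le_add
      (measure_not_hasCommonNeighbours_le_exp hw hC0 hC h2)
      (measure_driftFluctuation_ge_le hα hd hd1 hw hC h2)))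
  refine ⟨T, hTm, hT1, ?_⟩
  filter_upwards [hT, ae_all_iff.2 hw.nonneg, ae_all_iff.2 hC] with ω hω h0 hCω m hm
  have hm1 : 1 ≤ m := (hT1 ω).trans hm.le
  have hmR : (1 : ℝ) ≤ m := by exact_mod_cast hm1
  have hgood := hω m hm
  simp only [hs, Set.mem_union, Set.mem_ofPred_eq, not_or, not_not, not_le] at hgood
  obtain ⟨hscale, hcn, hfl⟩ := hgood
  rw [not_lt] at hscale
  refine ⟨existsUnique_isCorrector hα hC0 h0 hCω hcn hscale, fun φ hφ => ?_⟩
  -- Here 2^{αk₀} ≤ (2^d Λ m)^{α/d}, the source of the power m^{α/d} and of the constant in F.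
  obtain ⟨k₀, hk₀, hr, hk⟩ := exists_scale hα hd1 (m := m) (r := Λ * m) (by nlinarith) hscale
  refine (energyOn_le_of_hasCommonNeighbours hα hd hC0 h0 hCω hcn hk₀ hr hφ).trans ?_
  obtain ⟨hr1, hr2⟩ := hrate m hm1
  have hS := driftMass_nonneg (d := d) α m
  have hfirst : d * 2 ^ d * C ^ 2 * (((2 : ℝ) ^ α) ^ k₀ * driftMass d α m ^ 2 * 2 ^ (m * d)) ≤
      F * (A * energyRate d α γ m) := by
    have hsplit : ((2 : ℝ) ^ d * (Λ * m)) ^ (α / d) =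
        (2 ^ d * Λ) ^ (α / d) * (m : ℝ) ^ (α / d) := by
      rw [← mul_assoc, Real.mul_rpow (by positivity) (by positivity)]
    rw [hsplit] at hk
    calc d * 2 ^ d * C ^ 2 * (((2 : ℝ) ^ α) ^ k₀ * driftMass d α m ^ 2 * 2 ^ (m * d))
        ≤ d * 2 ^ d * C ^ 2 * ((2 ^ d * Λ) ^ (α / d) * (m : ℝ) ^ (α / d) *
            (driftMass d α m + 1) ^ 2 * 2 ^ (m * d)) := by
          gcongr
          linarith
      _ = F * ((m : ℝ) ^ (α / d) * (driftMass d α m + 1) ^ 2 * 2 ^ (m * d)) := by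
          rw [hF]; ring
      _ ≤ F * (A * energyRate d α γ m) := by gcongr
  calc _ ≤ τ * (F * (A * energyRate d α γ m) + A * energyRate d α γ m) := by
        refine mul_le_mul_of_nonneg_left (add_le_add hfirst (hfl.le.trans hr2)) hτ0.le
    _ = _ := by ring
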